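/- Let $d\ge 2$, $n\ge 3$, $N\in\mathbb N$, and let $m_1,\dots,m_N\in\mathbb R$ be masses with $m_\kappa>0$ for all $\kappa$ if $d=2,3$, and $m_\kappa\ge 0$ for all $\kappa$ if $d\ge 4$. Write $x=(x^0,\vec x)\in\mathbb R\times\mathbb R^{d-1}=\mathbb R^d$, $x\cdot y=x^0y^0-\vec x\cdot\vec y$, $k^2=k\cdot k$ and $\delta^\pm_m(k)=\theta(\pm k^0)\,\delta(k^2-m^2)$, i.e. $\delta_m^\pm$ is the measure $d\vec k/(2\omega)$ on the shell $k^0=\pm\omega$, $\omega=\sqrt{|\vec k|^2+m^2}$. For $\bar\kappa=(\kappa_1,\dots,\kappa_n)\in\{1,\dots,N\}^n$ let $$\hat G_{n,\bar\kappa}(k_1,\dots,k_n)=\Big\{\sum_{j=1}^n\prod_{l=1}^{j-1}\delta^-_{m_{\kappa_l}}(k_l)\,\frac{1}{k_j^2-m_{\kappa_j}^2}\prod_{l=j+1}^n\delta^+_{m_{\kappa_l}}(k_l)\Big\}\,\delta\Big(\sum_{l=1}^nk_l\Big),$$ where the singularities are understood in the sense of the Cauchy principal value: $\hat G_{n,\bar\kappa}(g)$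 is the limit as $\eta\to+0$ of the sum over $j$ of the (absolutely convergent) integrals obtained by carrying out the delta distributions (so that $k_j=-\sum_{l\ne j}k_l$) and replacing $1/(k_j^2-m_{\kappa_j}^2)$ by $0$ wherever $|k_j^0-\omega_j|\le\eta$ or $|k_j^0+\omega_j|\le\eta$, $\omega_j=\sqrt{|\vec k_j|^2+m_{\kappa_j}^2}$. Then, for every $\bar\kappa$, these integrals converge absolutely for every Schwartz function $g$ on $\mathbb R^{dn}$ and every $\eta>0$, the limit exists and defines a tempered distribution $\hat G_{n,\bar\kappa}$ on $\mathbb R^{dn}$; and the structure function $G_n$, defined as the inverse Fourier transform of $\hat G_n=\sum_{\kappa_1,\dots,\kappa_n=1}^N\hat G_{n,\bar\kappa}$ (that is, $G_n(f)=\hat G_n(\bar{\mathcal F}f)$ with $(\bar{\mathcal F}f)(k)=(2\pi)^{-nd/2}\int_{\mathbb R^{dn}} e^{i(k_1\cdot x_1+\cdots+k_n\cdot x_n)}f(x)\,dx$), satisfies the weak time zero field condition. Explicitly: let $\varphi$ be any real, symmetric Schwartz function on $\mathbb R$ with support in $[-1,1]$ and $\int\varphi\,dx=1$, and $\varphi_\epsilon(x)=\varphi(x/\epsilon)/\epsilon$.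 For $j=1,\dots,n-1$ let $\mathcal S_{n,j}$ be the space of complex-valued Schwartz functions of the variables $(x_1,\dots,x_{j-1},\vec x_j,\vec x_{j+1},x_{j+2},\dots,x_n)$, and define $G_{n,j,\epsilon}(0,0)\in\mathcal S_{n,j}'$ by letting $G_n$ act on $$f(x_1,\dots,x_{j-1},\vec x_j,\vec x_{j+1},x_{j+2},\dots,x_n)\,\varphi_\epsilon(-x_j^0)\,\varphi_\epsilon(-x_{j+1}^0),\qquad f\in\mathcal S_{n,j}.$$ Then for every $j=1,\dots,n-1$ the limit $\lim_{\epsilon\to+0}G_{n,j,\epsilon}(0,0)$ exists in $\mathcal S_{n,j}'$ (in the topology of pointwise convergence), that is, as a tempered distribution in the remaining variables. -/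

import Mathlib

open MeasureTheory Filter Topology SchwartzMap
open scoped FourierTransform ContDiff

noncomputable section

namespace StructureFunction

/-! Throughout, `s = d - 1` is the dimension of space and `d = s + 1` that of space-time.
A point of space-time is indexed by `Fin (s + 1)`; the index `0` is the time (energy) component. -/

/-- `n`-point configurations `(x_1, …, x_n)` of space-time `ℝ^d`, `d = s + 1`, i.e. `ℝ^{dn}`. -/
abbrev Config (n s : ℕ) : Type := EuclideanSpace ℝ (Fin n × Fin (s + 1))

/-- All components of `(x_1, …, x_n)` but the two times `x_j^0` and `x_{j+1}^0`
(the points are numbered from `0` here). -/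
abbrev ReducedIndex (n s j : ℕ) : Type :=
  {i : Fin n × Fin (s + 1) // ¬ (i.2 = 0 ∧ ((i.1 : ℕ) = j ∨ (i.1 : ℕ) = j + 1))}

/-- The space of the variables
`(x_1, …, x_{j-1}, \vec x_j, \vec x_{j+1}, x_{j+2}, …, x_n)`. -/
abbrev ReducedConfig (n s j : ℕ) : Type := EuclideanSpace ℝ (ReducedIndex n s j)

/-! ### Tensor products of test functions -/

section Tensor

variable {V V₁ V₂ : Type*}
  [NormedAddCommGroup V] [NormedSpace ℝ V] [FiniteDimensional ℝ V]
  [NormedAddCommGroup V₁] [NormedSpace ℝ V₁]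
  [NormedAddCommGroup V₂] [NormedSpace ℝ V₂]

theorem exists_norm_le_of_injective (A : V →L[ℝ] V₁) (B : V →L[ℝ] V₂)
    (hAB : Function.Injective fun x => (A x, B x)) :
    ∃ C : ℝ, 0 ≤ C ∧ ∀ x, ‖x‖ ≤ C * (‖A x‖ + ‖B x‖) := by
  obtain ⟨K, -, hK⟩ := LinearMap.exists_antilipschitzWith (A.prod B : V →ₗ[ℝ] V₁ × V₂)
    (LinearMap.ker_eq_bot.2 hAB)
  refine ⟨K, K.2, fun x => ?_⟩
  have h := hK.le_mul_dist x 0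
  rw [dist_zero_right, map_zero, dist_zero_right] at h
  refine h.trans ?_
  gcongr
  exact max_le (le_add_of_nonneg_right (norm_nonneg _)) (le_add_of_nonneg_left (norm_nonneg _))

theorem norm_iteratedFDeriv_comp_le_pow {V V₁ : Type*} [NormedAddCommGroup V] [NormedSpace ℝ V]
    [NormedAddCommGroup V₁] [NormedSpace ℝ V₁] (A : V →L[ℝ] V₁) (f : SchwartzMap V₁ ℂ) (i : ℕ) (x : V) :
    ‖iteratedFDeriv ℝ i (fun y => f (A y)) x‖ ≤ ‖A‖ ^ i * ‖iteratedFDeriv ℝ i f (A x)‖ := by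
  have h := A.iteratedFDeriv_comp_right (f := f) (f.smooth ⊤) x (i := i) (mod_cast le_top)
  have h2 : iteratedFDeriv ℝ i (fun y => f (A y)) x = iteratedFDeriv ℝ i (f ∘ A) x := rfl
  rw [h2, h]
  refine (ContinuousMultilinearMap.norm_compContinuousLinearMap_le _ _).trans ?_
  simp [mul_comm]

/-- The map `f ↦ (x ↦ f (A x) h (B x))` on Schwartz functions, where `x ↦ (A x, B x)` is
injective. -/
def tensorRightCLM (A : V →L[ℝ] V₁) (B : V →L[ℝ] V₂)
    (hAB : Function.Injective fun x => (A x, B x)) (h : SchwartzMap V₂ ℂ) :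
    SchwartzMap V₁ ℂ →L[ℂ] SchwartzMap V ℂ :=
  SchwartzMap.mkCLM (fun f x => f (A x) * h (B x))
    (fun f g x => by simp [add_mul]) (fun a f x => by simp [mul_assoc])
    (fun f => ((f.smooth ⊤).comp A.contDiff).mul ((h.smooth ⊤).comp B.contDiff)) <| by
  rintro ⟨k, n⟩
  obtain ⟨C, hC, hle⟩ := exists_norm_le_of_injective A B hAB
  let S : SchwartzMap V₁ ℂ → ℝ := fun f =>
    ((Finset.Iic (k, n)).sup (schwartzSeminormFamily ℂ V₁ ℂ)) f
  let M : ℕ → ℝ := fun i => SchwartzMap.seminorm ℂ 0 i h + SchwartzMap.seminorm ℂ k i h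
  refine ⟨Finset.Iic (k, n),
    ∑ i ∈ Finset.range (n + 1), (n.choose i : ℝ) * ((C * 2) ^ k *
      (‖A‖ ^ i * (‖B‖ ^ (n - i) * M (n - i)))), ?_, fun f x => ?_⟩
  · refine Finset.sum_nonneg fun i _ => ?_
    have : 0 ≤ M (n - i) := add_nonneg (apply_nonneg _ _) (apply_nonneg _ _)
    positivity
  have hL := norm_iteratedFDeriv_mul_le (𝕜 := ℝ) (N := ∞) (n := n)
    (f := fun y => f (A y)) (g := fun y => h (B y))
    ((f.smooth ⊤).comp A.contDiff) ((h.smooth ⊤).comp B.contDiff) x (mod_cast le_top)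
  refine (mul_le_mul_of_nonneg_left hL (by positivity)).trans ?_
  rw [Finset.mul_sum, Finset.sum_mul]
  refine Finset.sum_le_sum fun i hi => ?_
  have hin : i ≤ n := Nat.lt_succ_iff.1 (Finset.mem_range.1 hi)
  have hS : ∀ k' ≤ k, ‖A x‖ ^ k' * ‖iteratedFDeriv ℝ i f (A x)‖ ≤ S f := fun k' hk' =>
    (SchwartzMap.le_seminorm ℂ k' i f (A x)).trans
      (Seminorm.le_def.1 (Finset.le_sup (f := schwartzSeminormFamily ℂ V₁ ℂ)
        (Finset.mem_Iic.2 (Prod.mk_le_mk.2 ⟨hk', hin⟩))) f)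
  have hS0 : ‖iteratedFDeriv ℝ i f (A x)‖ ≤ S f := by simpa using hS 0 (Nat.zero_le _)
  have hSk := hS k le_rfl
  have hM0 : ‖iteratedFDeriv ℝ (n - i) h (B x)‖ ≤ SchwartzMap.seminorm ℂ 0 (n - i) h := by
    simpa using SchwartzMap.le_seminorm ℂ 0 (n - i) h (B x)
  have hMk := SchwartzMap.le_seminorm ℂ k (n - i) h (B x)
  have hx : ‖x‖ ^ k ≤ (C * 2) ^ k * (‖A x‖ ^ k + ‖B x‖ ^ k) := by
    have h1 : ‖A x‖ + ‖B x‖ ≤ 2 * max ‖A x‖ ‖B x‖ := by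
      linarith [le_max_left ‖A x‖ ‖B x‖, le_max_right ‖A x‖ ‖B x‖]
    have h2 : (max ‖A x‖ ‖B x‖) ^ k ≤ ‖A x‖ ^ k + ‖B x‖ ^ k := by
      rcases max_choice ‖A x‖ ‖B x‖ with h | h <;> rw [h]
      · exact le_add_of_nonneg_right (by positivity)
      · exact le_add_of_nonneg_left (by positivity)
    calc ‖x‖ ^ k ≤ (C * (2 * max ‖A x‖ ‖B x‖)) ^ k := by
          gcongr
          exact (hle x).trans (mul_le_mul_of_nonneg_left h1 hC)
      _ = (C * 2) ^ k * (max ‖A x‖ ‖B x‖) ^ k := by rw [← mul_assoc, mul_pow]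
      _ ≤ _ := by gcongr
  have hA := norm_iteratedFDeriv_comp_le_pow A f i x
  have hB := norm_iteratedFDeriv_comp_le_pow B h (n - i) x
  have hSnn : 0 ≤ S f := apply_nonneg _ _
  set a := ‖iteratedFDeriv ℝ i f (A x)‖
  set b := ‖iteratedFDeriv ℝ (n - i) h (B x)‖
  have ha : 0 ≤ a := norm_nonneg _
  have hb : 0 ≤ b := norm_nonneg _
  have key : (‖A x‖ ^ k + ‖B x‖ ^ k) * (a * b) ≤ S f * M (n - i) := by
    have e1 : (‖A x‖ ^ k * a) * b ≤ S f * SchwartzMap.seminorm ℂ 0 (n - i) h :=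
      mul_le_mul hSk hM0 hb hSnn
    have e2 : a * (‖B x‖ ^ k * b) ≤ S f * SchwartzMap.seminorm ℂ k (n - i) h :=
      mul_le_mul hS0 hMk (by positivity) hSnn
    calc _ = (‖A x‖ ^ k * a) * b + a * (‖B x‖ ^ k * b) := by ring
      _ ≤ _ := add_le_add e1 e2
      _ = S f * M (n - i) := by simp only [M]; ring
  calc ‖x‖ ^ k * ((n.choose i : ℝ) * ‖iteratedFDeriv ℝ i (fun y => f (A y)) x‖ *
        ‖iteratedFDeriv ℝ (n - i) (fun y => h (B y)) x‖)
      ≤ ((C * 2) ^ k * (‖A x‖ ^ k + ‖B x‖ ^ k)) *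
          ((n.choose i : ℝ) * (‖A‖ ^ i * a) * (‖B‖ ^ (n - i) * b)) := by gcongr
    _ = (n.choose i : ℝ) * ((C * 2) ^ k * (‖A‖ ^ i * (‖B‖ ^ (n - i) *
          ((‖A x‖ ^ k + ‖B x‖ ^ k) * (a * b))))) := by ring
    _ ≤ (n.choose i : ℝ) * ((C * 2) ^ k * (‖A‖ ^ i * (‖B‖ ^ (n - i) *
          (S f * M (n - i))))) := by gcongr
    _ = _ := by simp only [S]; ring

@[simp] theorem tensorRightCLM_apply (A : V →L[ℝ] V₁) (B : V →L[ℝ] V₂)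
    (hAB : Function.Injective fun x => (A x, B x)) (h : SchwartzMap V₂ ℂ)
    (f : SchwartzMap V₁ ℂ) (x : V) :
    tensorRightCLM A B hAB h f x = f (A x) * h (B x) := rfl

end Tensor

/-! ### The weak time zero field condition -/

/-- The admissible regularising functions: real Schwartz functions `φ` on `ℝ` that are symmetric,
supported in `[-1, 1]` and of integral one. -/
structure IsMollifier (φ : SchwartzMap ℝ ℝ) : Prop where
  symmetric : ∀ x, φ (-x) = φ x
  support_subset : Function.support φ ⊆ Set.Icc (-1) 1
  integral_eq_one : ∫ x, φ x = 1

/-- The test function `x ↦ φ_ε (t - x)` for `φ_ε (y) = φ (y / ε) / ε`, where `ε ≠ 0`. -/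
def approxDelta (φ : SchwartzMap ℝ ℝ) (ε t : ℝ) : SchwartzMap ℝ ℂ :=
  if hε : ε = 0 then 0
  else SchwartzMap.postcompCLM (𝕜 := ℝ) Complex.ofRealCLM (ε⁻¹ •
    SchwartzMap.compCLM ℝ (g := fun x : ℝ => (t - x) / ε)
      (by simp only [div_eq_mul_inv]; fun_prop)
      ⟨1, |t| + |ε|, fun x => by
        have h : x = t - ε * ((t - x) / ε) := by field_simp; ring
        have h1 : |x| ≤ |t| + |ε| * |(t - x) / ε| := by
          conv_lhs => rw [h]
          exact (abs_sub _ _).trans (by rw [abs_mul])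
        rw [Real.norm_eq_abs, Real.norm_eq_abs, pow_one]
        nlinarith [abs_nonneg t, abs_nonneg ε, abs_nonneg ((t - x) / ε),
          mul_nonneg (abs_nonneg t) (abs_nonneg ((t - x) / ε))]⟩ φ)

@[simp] theorem approxDelta_apply (φ : SchwartzMap ℝ ℝ) (ε t x : ℝ) :
    approxDelta φ ε t x = ((φ ((t - x) / ε) / ε : ℝ) : ℂ) := by
  unfold approxDelta
  split_ifs with hε
  · simp [hε]
  · simp [div_eq_inv_mul]

/-- `(x_1, …, x_n) ↦ (x_1, …, x_{j-1}, \vec x_j, \vec x_{j+1}, x_{j+2}, …, x_n)`. -/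
def reduce (n s j : ℕ) : Config n s →L[ℝ] ReducedConfig n s j :=
  LinearMap.toContinuousLinearMap
    { toFun := fun x => WithLp.toLp 2 fun i => x i.1
      map_add' := fun _ _ => rfl
      map_smul' := fun _ _ => rfl }

@[simp] theorem reduce_apply (n s j : ℕ) (x : Config n s) (i : ReducedIndex n s j) :
    reduce n s j x i = x i.1 := rfl

/-- The coordinate `x_l^0` of `(x_1, …, x_n)`. -/
def time {n : ℕ} (s : ℕ) (l : Fin n) : Config n s →L[ℝ] ℝ := EuclideanSpace.proj (l, 0)

@[simp] theorem time_apply {n : ℕ} (s : ℕ) (l : Fin n) (x : Config n s) :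
    time s l x = x (l, 0) := rfl

/-- `(x_j^0, x_{j+1}^0)`. -/
def times {n : ℕ} (s j : ℕ) (hj : j + 1 < n) : Config n s →L[ℝ] ℝ × ℝ :=
  (time s ⟨j, Nat.lt_of_succ_lt hj⟩).prod (time s ⟨j + 1, hj⟩)

theorem injective_reduce_times {n : ℕ} (s j : ℕ) (hj : j + 1 < n) :
    Function.Injective fun x : Config n s => (reduce n s j x, times s j hj x) := by
  intro x y hxy
  obtain ⟨h1, h2⟩ := Prod.mk.inj hxy
  obtain ⟨h3, h4⟩ := Prod.mk.inj h2
  ext ⟨l, μ⟩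
  by_cases hi : μ = 0 ∧ ((l : ℕ) = j ∨ (l : ℕ) = j + 1)
  · obtain ⟨rfl, h | h⟩ := hi
    · have : l = ⟨j, Nat.lt_of_succ_lt hj⟩ := Fin.ext h
      rw [this]; exact h3
    · have : l = ⟨j + 1, hj⟩ := Fin.ext h
      rw [this]; exact h4
  · have := congrArg (fun z : ReducedConfig n s j => z ⟨(l, μ), hi⟩) h1
    simpa using this

theorem injective_fst_snd : Function.Injective fun x : ℝ × ℝ =>
    (ContinuousLinearMap.fst ℝ ℝ ℝ x, ContinuousLinearMap.snd ℝ ℝ ℝ x) :=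
  fun _ _ h => h

/-- The continuous map `𝒮_{n,j} → 𝒮_n` that sends `f` to
`f (x_1, …, x_{j-1}, \vec x_j, \vec x_{j+1}, x_{j+2}, …, x_n) φ_ε(t - x_j^0) φ_ε(t' - x_{j+1}^0)`. -/
def smearCLM {n s : ℕ} (φ : SchwartzMap ℝ ℝ) (j : ℕ) (hj : j + 1 < n) (ε t t' : ℝ) :
    SchwartzMap (ReducedConfig n s j) ℂ →L[ℂ] SchwartzMap (Config n s) ℂ :=
  tensorRightCLM (reduce n s j) (times s j hj) (injective_reduce_times s j hj)
    (tensorRightCLM (ContinuousLinearMap.fst ℝ ℝ ℝ) (ContinuousLinearMap.snd ℝ ℝ ℝ)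
      injective_fst_snd (approxDelta φ ε t') (approxDelta φ ε t))

theorem smearCLM_apply {n s : ℕ} (φ : SchwartzMap ℝ ℝ) (j : ℕ) (hj : j + 1 < n) (ε t t' : ℝ)
    (f : SchwartzMap (ReducedConfig n s j) ℂ) (x : Config n s) :
    smearCLM φ j hj ε t t' f x = f (reduce n s j x) *
      (((φ ((t - x (⟨j, Nat.lt_of_succ_lt hj⟩, 0)) / ε) / ε : ℝ) : ℂ) *
        ((φ ((t' - x (⟨j + 1, hj⟩, 0)) / ε) / ε : ℝ) : ℂ)) := by
  rw [smearCLM, tensorRightCLM_apply, tensorRightCLM_apply, approxDelta_apply, approxDelta_apply]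
  rfl

/-- The distribution `W_{n,j,ε}(t, t')` in `𝒮_{n,j}'`. -/
def atTimes {n s : ℕ} (φ : SchwartzMap ℝ ℝ) (W : TemperedDistribution (Config n s) ℂ)
    (j : ℕ) (hj : j + 1 < n) (ε t t' : ℝ) : TemperedDistribution (ReducedConfig n s j) ℂ :=
  PointwiseConvergenceCLM.precomp ℂ (smearCLM φ j hj ε t t') W

theorem atTimes_apply {n s : ℕ} (φ : SchwartzMap ℝ ℝ) (W : TemperedDistribution (Config n s) ℂ)
    (j : ℕ) (hj : j + 1 < n) (ε t t' : ℝ) (f : SchwartzMap (ReducedConfig n s j) ℂ) :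
    atTimes φ W j hj ε t t' f = W (smearCLM φ j hj ε t t' f) := rfl

/-- The weak time zero field condition: for each pair of neighbouring arguments,
`lim_{ε → +0} W_{n,j,ε}(0, 0)` exists in `𝒮_{n,j}'`. -/
def WeakTimeZero {n s : ℕ} (φ : SchwartzMap ℝ ℝ) (W : TemperedDistribution (Config n s) ℂ) :
    Prop :=
  ∀ (j : ℕ) (hj : j + 1 < n), ∃ W₀ : TemperedDistribution (ReducedConfig n s j) ℂ,
    Tendsto (fun ε : ℝ => atTimes φ W j hj ε 0 0) (𝓝[>] 0) (𝓝 W₀)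

/-! ### The Fourier transform with respect to the Minkowski product -/

/-- The signs of the Minkowski metric `(+, -, …, -)`. -/
def metricSign {s : ℕ} (μ : Fin (s + 1)) : ℝ := if μ = 0 then 1 else -1

/-- `k_1 · x_1 + ⋯ + k_n · x_n` with the Minkowski product `k · x = k^0 x^0 - \vec k · \vec x`. -/
def minkowskiDot {n s : ℕ} (k x : Config n s) : ℝ :=
  ∑ i : Fin n × Fin (s + 1), metricSign i.2 * (k i * x i)

theorem metricSign_mul_self {s : ℕ} (μ : Fin (s + 1)) : metricSign μ * metricSign μ = 1 := by
  unfold metricSign; split_ifs <;> norm_num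

/-- `k ↦ (k_l^0, - \vec k_l)_l / 2π`. -/
def rescale (n s : ℕ) : Config n s ≃L[ℝ] Config n s :=
  LinearEquiv.toContinuousLinearEquiv
    { toFun := fun k => WithLp.toLp 2 fun i => (2 * Real.pi)⁻¹ * metricSign i.2 * k i
      invFun := fun k => WithLp.toLp 2 fun i => (2 * Real.pi) * metricSign i.2 * k i
      map_add' := fun x y => by ext i; simp [mul_add]
      map_smul' := fun c x => by ext i; simp; ring
      left_inv := fun x => by
        ext i
        have := metricSign_mul_self i.2
        have hpi := Real.pi_ne_zero
        simp only
        field_simp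
        linear_combination x i * this
      right_inv := fun x => by
        ext i
        have := metricSign_mul_self i.2
        have hpi := Real.pi_ne_zero
        simp only
        field_simp
        linear_combination x i * this }

/-- The inverse Fourier transform of Schwartz functions,
`f ↦ (k ↦ (2π)^{-nd/2} ∫ e^{i (k_1 · x_1 + ⋯ + k_n · x_n)} f(x) dx)`; see
`fourierInvCLM_apply`. -/
def fourierInvCLM (n s : ℕ) : SchwartzMap (Config n s) ℂ →L[ℂ] SchwartzMap (Config n s) ℂ :=
  (((2 * Real.pi) ^ (-((n : ℝ) * ((s : ℝ) + 1) / 2)) : ℝ) : ℂ) •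
    (SchwartzMap.compCLMOfContinuousLinearEquiv ℂ (rescale n s) ∘L
      FourierTransform.fourierInvCLM ℂ (SchwartzMap (Config n s) ℂ))

theorem fourierInvCLM_apply {n s : ℕ} (f : SchwartzMap (Config n s) ℂ) (k : Config n s) :
    fourierInvCLM n s f k = (((2 * Real.pi) ^ (-((n : ℝ) * ((s : ℝ) + 1) / 2)) : ℝ) : ℂ) *
      ∫ x, Complex.exp (Complex.I * (minkowskiDot k x : ℂ)) * f x := by
  have h : fourierInvCLM n s f k = (((2 * Real.pi) ^ (-((n : ℝ) * ((s : ℝ) + 1) / 2)) : ℝ) : ℂ) *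
      (𝓕⁻ f) (rescale n s k) := rfl
  rw [h, SchwartzMap.fourierInv_coe, Real.fourierInv_eq']
  congr 1
  refine integral_congr_ae (Eventually.of_forall fun x => ?_)
  have e : 2 * Real.pi * inner ℝ x (rescale n s k) = minkowskiDot k x := by
    have hpi := Real.pi_ne_zero
    simp only [rescale, minkowskiDot, PiLp.inner_apply, Finset.mul_sum]
    refine Finset.sum_congr rfl fun i _ => ?_
    simp
    field_simp
  simp only [smul_eq_mul]
  rw [e, mul_comm Complex.I]

/-- The inverse Fourier transform of tempered distributions. -/
def fourierInv {n s : ℕ} (T : TemperedDistribution (Config n s) ℂ) :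
    TemperedDistribution (Config n s) ℂ :=
  PointwiseConvergenceCLM.precomp ℂ (fourierInvCLM n s) T

theorem fourierInv_apply {n s : ℕ} (T : TemperedDistribution (Config n s) ℂ)
    (f : SchwartzMap (Config n s) ℂ) : fourierInv T f = T (fourierInvCLM n s f) := rfl

/-! ### The structure functions in momentum space -/

/-- `ω = (|\vec k|^2 + m^2)^{1/2}`. -/
def energy {s : ℕ} (m : ℝ) (p : Fin s → ℝ) : ℝ := √(∑ a, p a ^ 2 + m ^ 2)

/-- The space part `\vec k` of `k`. -/
def spatial {s : ℕ} (k : Fin (s + 1) → ℝ) : Fin s → ℝ := fun a => k a.succ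

/-- The Minkowski square `k^2 = (k^0)^2 - |\vec k|^2`. -/
def minkowskiSq {s : ℕ} (k : Fin (s + 1) → ℝ) : ℝ := k 0 ^ 2 - ∑ a, spatial k a ^ 2

/-- The point `(± ω, \vec p)` of the mass shell `k^2 = m^2`. -/
def onShell {s : ℕ} (m sign : ℝ) (p : Fin s → ℝ) : Fin (s + 1) → ℝ :=
  Fin.cons (sign * energy m p) p

/-- `1 / (k^2 - m^2)` with its singularities at the energies `k^0 = ± ω` cut out, as in the
definition of the Cauchy principal value: the value is `0` at distance at most `η` from them. -/
def cutPropagator {s : ℕ} (η m : ℝ) (k : Fin (s + 1) → ℝ) : ℝ :=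
  if η < |k 0 - energy m (spatial k)| ∧ η < |k 0 + energy m (spatial k)| then
    1 / (minkowskiSq k - m ^ 2)
  else 0

/-- The space momenta of all the particles but the `j`-th. -/
abbrev OtherMomenta {n : ℕ} (s : ℕ) (j : Fin n) : Type := {l : Fin n // l ≠ j} → Fin s → ℝ

/-- The momenta on the support of
`∏_{l<j} δ^-_{m_l}(k_l) ∏_{l>j} δ^+_{m_l}(k_l) δ(k_1 + ⋯ + k_n)`: the energy of `k_l` is `-ω_l`
for `l < j` and `ω_l` for `l > j`, and `k_j = - ∑_{l ≠ j} k_l`. -/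
def momenta {n s : ℕ} (m : Fin n → ℝ) (j : Fin n) (p : OtherMomenta s j) :
    Fin n → Fin (s + 1) → ℝ := fun l =>
  if h : l = j then -∑ i : {l : Fin n // l ≠ j}, onShell (m i) (if i.1 < j then -1 else 1) (p i)
  else onShell (m l) (if l < j then -1 else 1) (p ⟨l, h⟩)

/-- A family of `n` momenta as a point of `ℝ^{dn}`. -/
def toConfig {n s : ℕ} (k : Fin n → Fin (s + 1) → ℝ) : Config n s :=
  WithLp.toLp 2 fun i => k i.1 i.2

/-- The integrand of the `j`-th summand of `\hat G_{n,κ}(g)`. The measure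
`δ^±_m(k) = θ(± k^0) δ(k^2 - m^2)` is `d\vec k / 2ω` on the mass shell `k^0 = ± ω`, and `k_j` is
integrated out by means of `δ(k_1 + ⋯ + k_n)`. -/
def summand {n s : ℕ} (m : Fin n → ℝ) (η : ℝ) (g : SchwartzMap (Config n s) ℂ) (j : Fin n)
    (p : OtherMomenta s j) : ℂ :=
  (((∏ l : {l : Fin n // l ≠ j}, 1 / (2 * energy (m l) (p l))) *
    cutPropagator η (m j) (momenta m j p j) : ℝ) : ℂ) * g (toConfig (momenta m j p))

/-- `T` is the distribution
`{∑_j ∏_{l<j} δ^-_{m_l}(k_l) 1/(k_j^2 - m_j^2) ∏_{l>j} δ^+_{m_l}(k_l)} δ(k_1 + ⋯ + k_n)`,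
where the singularities are understood in the sense of the Cauchy principal value
(of the sum over `j`). -/
structure IsStructureDistribution {n s : ℕ} (m : Fin n → ℝ)
    (T : TemperedDistribution (Config n s) ℂ) : Prop where
  integrable : ∀ (g : SchwartzMap (Config n s) ℂ) (η : ℝ), 0 < η → ∀ j : Fin n,
    Integrable (summand m η g j)
  tendsto : ∀ g : SchwartzMap (Config n s) ℂ,
    Tendsto (fun η : ℝ => ∑ j : Fin n, ∫ p, summand m η g j p) (𝓝[>] 0) (𝓝 (T g))

end StructureFunction

end

noncomputable section

namespace StructureFunction

/-! ### Elementary inequalities -/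

/-! Write `ω_l` for the energies and `B_j = ∑_{l<j} ω_l - ∑_{l≥j} ω_l` (`signedEnergy`, particles
numbered from 0). On the support of the `j`-th summand, `k_j^0 - ω_j = B_j` and `k_j^0 + ω_j =
B_{j+1}`, hence `1/(k_j^2 - m_j^2) = 1/(B_j B_{j+1}) = (1/2ω_j)(1/B_j - 1/B_{j+1})`. All summands
therefore share the prefactor `∏_l 1/(2ω_l)`, and what remains is `∑_j (1/B_j - 1/B_{j+1}) g_j`,
where `g_j` is the test function at the `j`-th family of momenta (`prod_mul_cutPropagator`).

Summation by parts produces the terms `(g_{j+1} - g_j)/B_{j+1}`. Passing from the `j`-th family to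
the next changes just two energies, each by `|B_{j+1}|` (`abs_toConfig_sub_le`), so a Lipschitz
bound on `g` in the energies cancels the singularity. The boundary terms are harmless because `|B_0|
= |B_n| = ∑ ω_l`. Thus the sum over `j`, unlike its single terms, has a majorant that is uniform in
the cut `η` (`norm_cutIntegrand_le`). The majorant is integrable over the `n - 1` free space
momenta: the inverse energies can be distributed with at most two powers on each of them, which is
integrable at zero momentum for `s ≥ 3`, and is bounded for positive mass. Since almost everywhere
no `B_j` vanishes (`ae_signedEnergy_ne_zero`), dominated convergence gives the limit `η → 0`.

The majorant requires decay in the space momenta only, none in the energies (`HasBound`). This gives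
the time zero condition: the inverse Fourier transform of a smeared function is a Schwartz function
of the reduced variables times `Φ(ε ξ_j^0) Φ(ε ξ_{j+1}^0)`, up to a constant, where `Φ` is the
Fourier transform of `φ` and `ξ` the rescaled momentum. For `ε ≤ 1` these products satisfy
`HasBound` uniformly, and they converge pointwise because `Φ(0) = 1`, so dominated convergence
applies again. -/

/-- Summation by parts for the cut differences `1 / B_j - 1 / B_{j+1}`, uniformly in the cut. -/
theorem norm_sum_cut_mul_le {n : ℕ} (hn : 0 < n) {B E : ℕ → ℝ} {G : ℕ → ℂ} {η w L : ℝ}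
    (hη : 0 ≤ η) (hw : 0 ≤ w) (hL : 0 ≤ L) (hE : ∀ j < n, 0 < E j)
    (hB : ∀ j < n, B (j + 1) = B j + 2 * E j) (h0 : E 0 ≤ |B 0|) (h1 : E (n - 1) ≤ |B n|)
    (hG : ∀ j < n, ‖G j‖ ≤ w) (hGL : ∀ j, j + 1 < n → ‖G (j + 1) - G j‖ ≤ L * |B (j + 1)|) :
    ‖∑ j ∈ Finset.range n,
      ((if η < |B j| ∧ η < |B (j + 1)| then 1 / B j - 1 / B (j + 1) else 0 : ℝ) : ℂ) * G j‖ ≤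
      n * L + 3 * w * ∑ j ∈ Finset.range n, 1 / E j := by
  -- `u j` cuts each reciprocal on its own and telescopes; `c j` is the joint cut of the statement.
  -- They disagree only where exactly one of `B j`, `B (j + 1)` is cut. These two are `2 * E j`
  -- apart, so the larger in modulus is at least `E j`, and the error is at most `1 / E j`.
  set u : ℕ → ℝ := fun j => if η < |B j| then 1 / B j else 0 with hu
  set c : ℕ → ℝ := fun j =>
    if η < |B j| ∧ η < |B (j + 1)| then 1 / B j - 1 / B (j + 1) else 0 with hc
  have hu1 : ∀ j r, 0 < r → r ≤ |B j| → |u j| ≤ 1 / r := by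
    intro j r hr hrB
    simp only [hu]
    split_ifs
    · rw [abs_div, abs_one]
      exact one_div_le_one_div_of_le hr hrB
    · simpa using hr.le
  have he : ∀ j < n, |c j - (u j - u (j + 1))| ≤ 1 / E j := by
    intro j hj
    have hE' := hE j hj
    have hBj := hB j hj
    simp only [hc, hu]
    by_cases ha : η < |B j| <;> by_cases hb : η < |B (j + 1)|
    · simp [ha, hb, hE'.le]
    · simp only [ha, hb, and_false, if_false, if_true, sub_zero, zero_sub, abs_neg]
      rw [abs_div, abs_one]
      refine one_div_le_one_div_of_le hE' ?_
      have := abs_sub (B (j + 1)) (B j)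
      have h2 : |B (j + 1) - B j| = 2 * E j := by rw [hBj]; simp [abs_of_pos hE']
      linarith [not_lt.1 hb]
    · simp only [ha, hb, false_and, if_false, if_true, zero_sub, neg_neg]
      rw [abs_div, abs_one]
      refine one_div_le_one_div_of_le hE' ?_
      have := abs_sub (B (j + 1)) (B j)
      have h2 : |B (j + 1) - B j| = 2 * E j := by rw [hBj]; simp [abs_of_pos hE']
      linarith [not_lt.1 ha]
    · simp [ha, hb, hE'.le]
  have hparts : ∀ k, ∑ j ∈ Finset.range (k + 1), ((u j : ℂ) - u (j + 1)) * G j =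
      u 0 * G 0 - u (k + 1) * G k +
        ∑ j ∈ Finset.range k, (u (j + 1) : ℂ) * (G (j + 1) - G j) := by
    intro k
    induction k with
    | zero => simp; ring
    | succ k ih => rw [Finset.sum_range_succ, ih, Finset.sum_range_succ _ k]; ring
  obtain ⟨k, rfl⟩ : ∃ k, n = k + 1 := ⟨n - 1, by omega⟩
  have hsplit : ∑ j ∈ Finset.range (k + 1), (c j : ℂ) * G j =
      ∑ j ∈ Finset.range (k + 1), ((u j : ℂ) - u (j + 1)) * G j +
      ∑ j ∈ Finset.range (k + 1), ((c j - (u j - u (j + 1)) : ℝ) : ℂ) * G j := by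
    rw [← Finset.sum_add_distrib]
    refine Finset.sum_congr rfl fun j _ => ?_
    push_cast; ring
  rw [hsplit, hparts]
  have e1 : ‖(u 0 : ℂ) * G 0‖ ≤ 1 / E 0 * w := by
    rw [norm_mul, Complex.norm_real, Real.norm_eq_abs]
    have := hE 0 hn
    exact mul_le_mul (hu1 0 _ this h0) (hG 0 hn) (norm_nonneg _) (by positivity)
  have e2 : ‖(u (k + 1) : ℂ) * G k‖ ≤ 1 / E k * w := by
    rw [norm_mul, Complex.norm_real, Real.norm_eq_abs]
    have := hE k (by omega)
    exact mul_le_mul (hu1 (k + 1) _ this h1) (hG k (by omega)) (norm_nonneg _) (by positivity)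
  have e3 : ‖∑ j ∈ Finset.range k, (u (j + 1) : ℂ) * (G (j + 1) - G j)‖ ≤ k * L := by
    refine (norm_sum_le_of_le _ (f := fun j => (u (j + 1) : ℂ) * (G (j + 1) - G j))
      (n := fun _ => L) fun j hj => ?_).trans (by simp)
    have hj' := Finset.mem_range.1 hj
    rw [norm_mul, Complex.norm_real, Real.norm_eq_abs]
    simp only [hu]
    split_ifs with h
    · have hpos : 0 < |B (j + 1)| := hη.trans_lt h
      rw [abs_div, abs_one]
      calc 1 / |B (j + 1)| * ‖G (j + 1) - G j‖ ≤ 1 / |B (j + 1)| * (L * |B (j + 1)|) := by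
            gcongr; exact hGL j (by omega)
        _ = L := by field_simp
    · simpa using hL
  have e4 : ‖∑ j ∈ Finset.range (k + 1), ((c j - (u j - u (j + 1)) : ℝ) : ℂ) * G j‖ ≤
      ∑ j ∈ Finset.range (k + 1), 1 / E j * w := by
    refine norm_sum_le_of_le _ fun j hj => ?_
    have hj' := Finset.mem_range.1 hj
    rw [norm_mul, Complex.norm_real, Real.norm_eq_abs]
    have := hE j hj'
    exact mul_le_mul (he j hj') (hG j hj') (norm_nonneg _) (by positivity)
  have hnn : ∀ j ∈ Finset.range (k + 1), 0 ≤ 1 / E j := fun j hj =>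
    (one_div_pos.2 (hE j (Finset.mem_range.1 hj))).le
  have s0 : 1 / E 0 ≤ ∑ j ∈ Finset.range (k + 1), 1 / E j :=
    Finset.single_le_sum (f := fun j => 1 / E j) hnn (Finset.mem_range.2 hn)
  have s1 : 1 / E k ≤ ∑ j ∈ Finset.range (k + 1), 1 / E j :=
    Finset.single_le_sum (f := fun j => 1 / E j) hnn (Finset.mem_range.2 (by omega))
  rw [← Finset.sum_mul] at e4
  set S := ∑ j ∈ Finset.range (k + 1), 1 / E j
  have t0 : 1 / E 0 * w ≤ S * w := by gcongr
  have t1 : 1 / E k * w ≤ S * w := by gcongr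
  have := norm_add_le (u 0 * G 0 - u (k + 1) * G k +
    ∑ j ∈ Finset.range k, (u (j + 1) : ℂ) * (G (j + 1) - G j))
    (∑ j ∈ Finset.range (k + 1), ((c j - (u j - u (j + 1)) : ℝ) : ℂ) * G j)
  have := norm_add_le ((u 0 : ℂ) * G 0 - u (k + 1) * G k)
    (∑ j ∈ Finset.range k, (u (j + 1) : ℂ) * (G (j + 1) - G j))
  have := norm_sub_le ((u 0 : ℂ) * G 0) (u (k + 1) * G k)
  push_cast at *
  linarith

/-- A factor too many in the full product is compensated by leaving out another variable. -/
theorem prod_mul_one_add_le_sum_prod {n : ℕ} (hn : 3 ≤ n) {a : Fin n → ℝ} (ha : ∀ l, 0 ≤ a l)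
    (i : Fin n) :
    (∏ l, a l) * (1 + a i) ≤ ∑ t, ∏ l : {l : Fin n // l ≠ t}, (1 + a l) ^ 2 := by
  -- Since `n ≥ 3`, two indices other than `i` exist; `t`, the one with the smaller value, is left
  -- out. Its factor is absorbed by `a t * a r ≤ (1 + a r) ^ 2`, and the surplus factor by `a i * (1
  -- + a i) ≤ (1 + a i) ^ 2`.
  obtain ⟨r, t, hri, hti, hrt, hle⟩ : ∃ r t : Fin n, r ≠ i ∧ t ≠ i ∧ r ≠ t ∧ a t ≤ a r := by
    have hcard : 1 < (Finset.univ.erase i).card := by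
      rw [Finset.card_erase_of_mem (Finset.mem_univ i), Finset.card_univ, Fintype.card_fin]; omega
    obtain ⟨x, hx, y, hy, hxy⟩ := Finset.one_lt_card.1 hcard
    rcases le_total (a x) (a y) with h | h
    · exact ⟨y, x, Finset.ne_of_mem_erase hy, Finset.ne_of_mem_erase hx, hxy.symm, h⟩
    · exact ⟨x, y, Finset.ne_of_mem_erase hx, Finset.ne_of_mem_erase hy, hxy, h⟩
  refine le_trans ?_ (Finset.single_le_sum
    (f := fun t => ∏ l : {l : Fin n // l ≠ t}, (1 + a l) ^ 2)
    (fun t _ => Finset.prod_nonneg fun l _ => sq_nonneg _) (Finset.mem_univ t))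
  have hsub : ∏ l : {l : Fin n // l ≠ t}, (1 + a l) ^ 2 =
      ∏ l ∈ Finset.univ.erase t, (1 + a l) ^ 2 :=
    (Finset.prod_subtype (p := fun l => l ≠ t) (Finset.univ.erase t) (fun l => by simp)
      fun l => (1 + a l) ^ 2).symm
  have hr : r ∈ Finset.univ.erase t := by simp [hrt]
  have hi : i ∈ (Finset.univ.erase t).erase r := by simp [hri.symm, hti.symm]
  rw [hsub, ← Finset.mul_prod_erase _ _ hr, ← Finset.mul_prod_erase _ _ hi,
    ← Finset.mul_prod_erase _ a (Finset.mem_univ t), ← Finset.mul_prod_erase _ a hr,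
    ← Finset.mul_prod_erase _ a hi]
  have h0 := ha t
  have h1 := ha r
  have h2 := ha i
  have e1 : ∏ l ∈ ((Finset.univ.erase t).erase r).erase i, a l ≤
      ∏ l ∈ ((Finset.univ.erase t).erase r).erase i, (1 + a l) ^ 2 :=
    Finset.prod_le_prod (fun l _ => ha l) fun l _ => by nlinarith [ha l]
  have e2 : a t * a r ≤ (1 + a r) ^ 2 := by nlinarith
  have e3 : a i * (1 + a i) ≤ (1 + a i) ^ 2 := by nlinarith
  calc _ = (a t * a r) * ((a i * (1 + a i)) *
        ∏ l ∈ ((Finset.univ.erase t).erase r).erase i, a l) := by ring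
    _ ≤ _ := by
        have := Finset.prod_nonneg fun l (_ : l ∈ ((Finset.univ.erase t).erase r).erase i) => ha l
        gcongr

/-! ### One-particle weights -/

theorem energy_nonneg {s : ℕ} (m : ℝ) (p : Fin s → ℝ) : 0 ≤ energy m p := Real.sqrt_nonneg _

theorem sq_energy {s : ℕ} (m : ℝ) (p : Fin s → ℝ) : energy m p ^ 2 = ∑ a, p a ^ 2 + m ^ 2 :=
  Real.sq_sqrt (by positivity)

theorem abs_le_energy {s : ℕ} (m : ℝ) (p : Fin s → ℝ) (a : Fin s) : |p a| ≤ energy m p := by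
  refine Real.abs_le_sqrt ?_
  have := Finset.single_le_sum (f := fun a => p a ^ 2) (fun _ _ => sq_nonneg _) (Finset.mem_univ a)
  linarith [sq_nonneg m]

theorem norm_le_energy {s : ℕ} (m : ℝ) (p : Fin s → ℝ) : ‖p‖ ≤ energy m p :=
  (pi_norm_le_iff_of_nonneg (energy_nonneg m p)).2 fun a => abs_le_energy m p a

theorem le_energy {s : ℕ} (m : ℝ) (p : Fin s → ℝ) : m ≤ energy m p :=
  Real.le_sqrt_of_sq_le (le_add_of_nonneg_left (by positivity))

@[fun_prop] theorem continuous_energy {s : ℕ} (m : ℝ) :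
    Continuous fun p : Fin s → ℝ => energy m p := by
  unfold energy; fun_prop

/-- An integrable function of polynomial decay on momentum space. -/
def decay {s : ℕ} (p : Fin s → ℝ) : ℝ := ((1 + ‖p‖) ^ (s + 1))⁻¹

theorem decay_pos {s : ℕ} (p : Fin s → ℝ) : 0 < decay p := by
  have := norm_nonneg p
  unfold decay; positivity

theorem decay_le_one {s : ℕ} (p : Fin s → ℝ) : decay p ≤ 1 :=
  inv_le_one_of_one_le₀ (one_le_pow₀ (by linarith [norm_nonneg p]))

theorem integrable_decay (s : ℕ) : Integrable (decay (s := s)) := by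
  have h := integrable_one_add_norm (E := Fin s → ℝ) (μ := volume) (r := (s + 1 : ℕ))
    (by simp)
  refine h.congr (Eventually.of_forall fun p => ?_)
  have : (0 : ℝ) ≤ 1 + ‖p‖ := by positivity
  simp only [decay]
  rw [Real.rpow_neg this, Real.rpow_natCast]

/-- In polar coordinates the Jacobian `y ^ (s - 1)` absorbs `y ^ (-2)` exactly when `s ≥ 3`; the
remaining integrand is at most `(1 + y) ^ (-4)`. -/
theorem integrable_inv_sq_norm_mul_decay {s : ℕ} (hs : 3 ≤ s) :
    Integrable fun p : Fin s → ℝ => (‖p‖ ^ 2)⁻¹ * decay p := by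
  have : Nonempty (Fin s) := ⟨⟨0, by omega⟩⟩
  refine (integrable_fun_norm_addHaar (E := Fin s → ℝ) (volume)
    (f := fun y : ℝ => (y ^ 2)⁻¹ * ((1 + y) ^ (s + 1))⁻¹)).2 ?_
  have h := (integrable_one_add_norm (E := ℝ) (μ := volume) (r := 2) (by simp)).integrableOn
    (s := Set.Ioi 0)
  refine Integrable.mono' h ?_ ?_
  · exact (Measurable.aestronglyMeasurable (by fun_prop))
  · refine (ae_restrict_iff' measurableSet_Ioi).2 (Eventually.of_forall fun y hy => ?_)
    have hy : 0 < y := hy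
    obtain ⟨k, rfl⟩ : ∃ k, s = k + 3 := ⟨s - 3, by omega⟩
    simp only [Module.finrank_fintype_fun_eq_card, Fintype.card_fin, smul_eq_mul, Real.norm_eq_abs]
    rw [abs_of_nonneg (by positivity), abs_of_pos hy, Real.rpow_neg (by positivity)]
    have h2 : (1 + y) ^ (2 : ℝ) = (1 + y) ^ 2 := by norm_cast
    rw [h2, show k + 3 - 1 = k + 2 from rfl]
    calc y ^ (k + 2) * ((y ^ 2)⁻¹ * ((1 + y) ^ (k + 3 + 1))⁻¹)
        = y ^ k * ((1 + y) ^ (k + 4))⁻¹ := by field_simp; ring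
      _ ≤ (1 + y) ^ k * ((1 + y) ^ (k + 4))⁻¹ := by gcongr; linarith
      _ = ((1 + y) ^ 4)⁻¹ := by rw [pow_add]; field_simp
      _ ≤ _ := by gcongr <;> linarith

theorem integrable_particle_weight {s : ℕ} {m : ℝ} (hm : 0 ≤ m) (hm' : s ≤ 2 → 0 < m) :
    Integrable fun p : Fin s → ℝ => (1 + 1 / (2 * energy m p)) ^ 2 * decay p := by
  have hmeas : AEStronglyMeasurable
      (fun p : Fin s → ℝ => (1 + 1 / (2 * energy m p)) ^ 2 * decay p) volume := by
    refine Measurable.aestronglyMeasurable ?_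
    have := (continuous_energy (s := s) m).measurable
    unfold decay
    fun_prop
  rcases hm.eq_or_lt with h0 | hpos
  · subst h0
    have hs : 3 ≤ s := by by_contra h; exact lt_irrefl _ (hm' (by omega))
    refine (((integrable_decay s).const_mul 2).add
      ((integrable_inv_sq_norm_mul_decay hs).const_mul 2)).mono' hmeas
      (Eventually.of_forall fun p => ?_)
    have hd := decay_pos p
    have he := energy_nonneg 0 p
    rw [Real.norm_of_nonneg (by positivity)]
    have h1 : 1 / (2 * energy 0 p) ≤ ‖p‖⁻¹ := by
      -- At `p = 0` both sides are `0` by the convention for division by zero.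
      rcases (norm_nonneg p).eq_or_lt with h | h
      · have : p = 0 := norm_eq_zero.1 h.symm
        subst this
        simp [energy]
      · rw [one_div]
        exact inv_anti₀ h (by linarith [norm_le_energy 0 p])
    have h2 : (1 + 1 / (2 * energy 0 p)) ^ 2 ≤ 2 + 2 * (‖p‖ ^ 2)⁻¹ := by
      rw [← inv_pow]
      have : 0 ≤ 1 / (2 * energy 0 p) := by positivity
      nlinarith [sq_nonneg (‖p‖⁻¹ - 1)]
    simp only [Pi.add_apply]
    nlinarith
  · refine ((integrable_decay s).const_mul ((1 + 1 / (2 * m)) ^ 2)).mono' hmeas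
      (Eventually.of_forall fun p => ?_)
    have hd := decay_pos p
    have he := le_energy m p
    have he' := hpos.trans_le he
    rw [Real.norm_of_nonneg (by positivity)]
    gcongr

/-! ### Momentum conservation

Families `q_1, …, q_n` of space momenta with `∑ q_l = 0`, in the coordinates `q_l`, `l ≠ j`. -/

/-- All the momenta but the `j`-th. -/
def others {n s : ℕ} (j : Fin n) : (Fin n → Fin s → ℝ) →ₗ[ℝ] OtherMomenta s j where
  toFun q := fun l => q l
  map_add' _ _ := rfl
  map_smul' _ _ := rfl

@[simp] theorem others_apply {n s : ℕ} (j : Fin n) (q : Fin n → Fin s → ℝ)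
    (l : {l : Fin n // l ≠ j}) : others j q l = q l := rfl

/-- The family of momenta of vanishing sum that is determined by all but the `j`-th. -/
def full {n s : ℕ} (j : Fin n) : OtherMomenta s j →ₗ[ℝ] (Fin n → Fin s → ℝ) where
  toFun p := fun l => if h : l = j then -∑ i, p i else p ⟨l, h⟩
  map_add' p q := by
    ext l a
    by_cases h : l = j
    · simp [h, Finset.sum_add_distrib]; ring
    · simp [h]
  map_smul' c p := by
    ext l a
    by_cases h : l = j
    · simp [h, Finset.mul_sum]
    · simp [h]

theorem full_self {n s : ℕ} (j : Fin n) (p : OtherMomenta s j) : full j p j = -∑ i, p i := by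
  simp [full]

theorem full_of_ne {n s : ℕ} {j l : Fin n} (h : l ≠ j) (p : OtherMomenta s j) :
    full j p l = p ⟨l, h⟩ := by
  simp [full, h]

theorem sum_eq_add_sum_ne {n : ℕ} {M : Type*} [AddCommMonoid M] (j : Fin n) (f : Fin n → M) :
    ∑ l, f l = f j + ∑ l : {l : Fin n // l ≠ j}, f l := by
  rw [← Finset.add_sum_erase _ f (Finset.mem_univ j)]
  congr 1
  exact Finset.sum_subtype (p := fun l => l ≠ j) (Finset.univ.erase j) (fun l => by simp) f

theorem prod_eq_mul_prod_ne {n : ℕ} {M : Type*} [CommMonoid M] (j : Fin n) (f : Fin n → M) :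
    ∏ l, f l = f j * ∏ l : {l : Fin n // l ≠ j}, f l := by
  rw [← Finset.mul_prod_erase _ f (Finset.mem_univ j)]
  congr 1
  exact Finset.prod_subtype (p := fun l => l ≠ j) (Finset.univ.erase j) (fun l => by simp) f

@[simp] theorem others_full {n s : ℕ} (j : Fin n) (p : OtherMomenta s j) :
    others j (full j p) = p := by
  funext l
  rw [others_apply, full_of_ne l.2]

theorem sum_full {n s : ℕ} (j : Fin n) (p : OtherMomenta s j) : ∑ l, full j p l = 0 := by
  rw [sum_eq_add_sum_ne j, full_self, neg_add_eq_zero]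
  exact Finset.sum_congr rfl fun l _ => (full_of_ne l.2 p).symm

theorem full_others {n s : ℕ} (j : Fin n) {q : Fin n → Fin s → ℝ} (hq : ∑ l, q l = 0) :
    full j (others j q) = q := by
  funext l
  by_cases h : l = j
  · subst h
    rw [sum_eq_add_sum_ne l, add_eq_zero_iff_neg_eq] at hq
    rw [full_self]
    change -∑ i : {i : Fin n // i ≠ l}, q i = q l
    rw [← hq, neg_neg]
  · rw [full_of_ne h, others_apply]

/-- The determinant of an involution squares to one. -/
theorem measurePreserving_of_comp_self {E : Type*} [NormedAddCommGroup E] [NormedSpace ℝ E]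
    [MeasurableSpace E] [BorelSpace E] [FiniteDimensional ℝ E] (μ : Measure E)
    [μ.IsAddHaarMeasure] (A : E →ₗ[ℝ] E) (hA : A ∘ₗ A = LinearMap.id) :
    MeasurePreserving A μ μ := by
  have hdet : LinearMap.det A * LinearMap.det A = 1 := by
    rw [← LinearMap.det_comp, hA, LinearMap.det_id]
  have hne : LinearMap.det A ≠ 0 := left_ne_zero_of_mul_eq_one hdet
  refine ⟨A.continuous_of_finiteDimensional.measurable, ?_⟩
  rw [Measure.map_linearMap_addHaar_eq_smul_addHaar μ hne, abs_inv]
  have : |LinearMap.det A| = 1 := by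
    rcases mul_self_eq_one_iff.1 hdet with h | h <;> simp [h]
  simp [this]

/-- The change of coordinates from `q_l`, `l ≠ i`, to `q_l`, `l ≠ j`, is measure preserving. -/
theorem measurePreserving_others_full {n s : ℕ} (i j : Fin n) :
    MeasurePreserving fun p : OtherMomenta s i => others j (full i p) := by
  -- Exchanging `q_i` and `q_j` preserves the vanishing of the sum, hence is an involution `A` in
  -- the coordinates `q_l`, `l ≠ i`. The change of coordinates is `A` followed by a relabelling of
  -- the factors.
  let e : Fin n ≃ Fin n := Equiv.swap i j
  let A : OtherMomenta s i →ₗ[ℝ] OtherMomenta s i :=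
    others i ∘ₗ LinearMap.funLeft ℝ (Fin s → ℝ) e ∘ₗ full i
  have hA : A ∘ₗ A = LinearMap.id := by
    refine LinearMap.ext fun p => ?_
    have h : full i (A p) = full i p ∘ e := full_others i (by
      exact (Equiv.sum_comp e (full i p)).trans (sum_full i p))
    change others i (full i (A p) ∘ e) = p
    rw [h, Function.comp_assoc]
    have : (e ∘ e : Fin n → Fin n) = id := by funext l; simp [e]
    rw [this, Function.comp_id, others_full]
  have hmp : MeasurePreserving A := measurePreserving_of_comp_self volume A hA
  let σ : {l : Fin n // l ≠ i} ≃ {l : Fin n // l ≠ j} := e.subtypeEquiv fun l => by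
    refine not_congr ⟨?_, fun h => e.injective (h.trans (Equiv.swap_apply_left i j).symm)⟩
    rintro rfl
    exact Equiv.swap_apply_left l j
  have h2 := volume_preserving_arrowCongr' σ (MeasurableEquiv.refl (Fin s → ℝ))
    (MeasurePreserving.id volume)
  have h3 := h2.comp hmp
  convert h3 using 1
  funext p l
  change full i p l = full i p (e (e.symm l))
  simp

/-! ### The energies of the momenta on the mass shells -/

/-- `∑_{l < j} ω_l - ∑_{l ≥ j} ω_l`. -/
def signedEnergy {n s : ℕ} (m : Fin n → ℝ) (q : Fin n → Fin s → ℝ) (j : ℕ) : ℝ :=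
  ∑ l : Fin n, if (l : ℕ) < j then energy (m l) (q l) else -energy (m l) (q l)

theorem signedEnergy_succ {n s : ℕ} (m : Fin n → ℝ) (q : Fin n → Fin s → ℝ) (j : Fin n) :
    signedEnergy m q (j + 1) = signedEnergy m q j + 2 * energy (m j) (q j) := by
  unfold signedEnergy
  rw [sum_eq_add_sum_ne j, sum_eq_add_sum_ne j]
  have : ∀ l : {l : Fin n // l ≠ j}, ((l : Fin n) : ℕ) < j + 1 ↔ ((l : Fin n) : ℕ) < j := by
    intro l
    have := Fin.val_ne_of_ne l.2
    omega
  simp only [this]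
  simp; ring

theorem signedEnergy_zero {n s : ℕ} (m : Fin n → ℝ) (q : Fin n → Fin s → ℝ) :
    signedEnergy m q 0 = -∑ l, energy (m l) (q l) := by
  simp [signedEnergy]

theorem signedEnergy_last {n s : ℕ} (m : Fin n → ℝ) (q : Fin n → Fin s → ℝ) :
    signedEnergy m q n = ∑ l, energy (m l) (q l) := by
  simp [signedEnergy]

/-- The energies of the momenta in the `j`-th summand. -/
def shellTime {n s : ℕ} (m : Fin n → ℝ) (j : Fin n) (q : Fin n → Fin s → ℝ) (l : Fin n) : ℝ :=
  if l = j then signedEnergy m q j + energy (m j) (q j)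
  else if l < j then -energy (m l) (q l) else energy (m l) (q l)

theorem momenta_others {n s : ℕ} (m : Fin n → ℝ) (j : Fin n) {q : Fin n → Fin s → ℝ}
    (hq : ∑ l, q l = 0) (l : Fin n) :
    momenta m j (others j q) l = Fin.cons (shellTime m j q l) (q l) := by
  unfold momenta shellTime
  split_ifs with h h'
  · subst h
    funext μ
    refine Fin.cases ?_ (fun a => ?_) μ
    · simp only [Pi.neg_apply, Finset.sum_apply, onShell, Fin.cons_zero, others_apply]
      unfold signedEnergy
      rw [sum_eq_add_sum_ne l, ← Finset.sum_neg_distrib]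
      simp only [lt_irrefl, if_false]
      rw [neg_add_eq_sub, sub_add_cancel]
      refine Finset.sum_congr rfl fun i _ => ?_
      have : ((i : Fin n) : ℕ) < l ↔ (i : Fin n) < l := Iff.rfl
      simp only [this]
      split_ifs <;> ring
    · simp only [Pi.neg_apply, Finset.sum_apply, onShell, Fin.cons_succ, others_apply]
      have := congrFun (congrFun (full_others l hq) l) a
      rw [full_self] at this
      simpa using this
  · simp [onShell]
  · simp [onShell]

/-- The two poles sit at `k_j^0 ∓ ω_j`, which are `B_j` and `B_{j+1}`: neighbouring summands share a
singular surface. -/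
theorem cutPropagator_momenta {n s : ℕ} (m : Fin n → ℝ) (η : ℝ) (j : Fin n)
    {q : Fin n → Fin s → ℝ} (hq : ∑ l, q l = 0) :
    cutPropagator η (m j) (momenta m j (others j q) j) =
      if η < |signedEnergy m q j| ∧ η < |signedEnergy m q (j + 1)| then
        1 / (signedEnergy m q j * signedEnergy m q (j + 1)) else 0 := by
  have hsp : spatial (Fin.cons (shellTime m j q j) (q j) : Fin (s + 1) → ℝ) = q j := by
    funext a; simp [spatial]
  rw [cutPropagator, momenta_others m j hq, minkowskiSq, hsp, signedEnergy_succ, Fin.cons_zero]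
  have h0 : shellTime m j q j = signedEnergy m q j + energy (m j) (q j) := by simp [shellTime]
  have h1 : (signedEnergy m q j + energy (m j) (q j)) ^ 2 - ∑ a, q j a ^ 2 - m j ^ 2 =
      signedEnergy m q j * (signedEnergy m q j + 2 * energy (m j) (q j)) := by
    linear_combination sq_energy (m j) (q j)
  rw [h0, h1, add_sub_cancel_right, add_assoc, ← two_mul]

/-- Partial fractions, using `B_{j+1} - B_j = 2ω_j`. They supply the missing factor `1/(2ω_j)`, so
that the prefactor no longer depends on `j`. -/
theorem prod_mul_cutPropagator {n s : ℕ} (m : Fin n → ℝ) {η : ℝ} (hη : 0 ≤ η) (j : Fin n)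
    {q : Fin n → Fin s → ℝ} (hq : ∑ l, q l = 0) (hpos : 0 < energy (m j) (q j)) :
    (∏ l : {l : Fin n // l ≠ j}, 1 / (2 * energy (m l) (others j q l))) *
      cutPropagator η (m j) (momenta m j (others j q) j) =
    (∏ l, 1 / (2 * energy (m l) (q l))) *
      if η < |signedEnergy m q j| ∧ η < |signedEnergy m q (j + 1)| then
        1 / signedEnergy m q j - 1 / signedEnergy m q (j + 1) else 0 := by
  rw [cutPropagator_momenta m η j hq, prod_eq_mul_prod_ne j]
  simp only [others_apply]
  split_ifs with h
  · have h0 : signedEnergy m q j ≠ 0 := abs_pos.1 (hη.trans_lt h.1)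
    have h1 : signedEnergy m q (j + 1) ≠ 0 := abs_pos.1 (hη.trans_lt h.2)
    have h2 := signedEnergy_succ m q j
    rw [div_sub_div _ _ h0 h1, h2]
    rw [h2] at h1
    field_simp
    ring
  · simp

@[fun_prop] theorem continuous_signedEnergy {n s : ℕ} (m : Fin n → ℝ) (j : ℕ) :
    Continuous fun q : Fin n → Fin s → ℝ => signedEnergy m q j := by
  unfold signedEnergy
  refine continuous_finsetSum _ fun l _ => ?_
  have := (continuous_energy (m l)).comp (continuous_apply (A := fun _ : Fin n => Fin s → ℝ) l)
  split_ifs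
  · exact this
  · exact this.neg

/-! ### Null sets -/

/-- Triangle inequality for the plane vectors `u (b + x, √c)` and `v (b + y, √c)`; `h3` is the
Cauchy–Schwarz inequality. -/
theorem sqrt_sq_add_convex {b c x y u v : ℝ} (hc : 0 ≤ c) (hu : 0 ≤ u) (hv : 0 ≤ v)
    (huv : u + v = 1) :
    √((b + (u * x + v * y)) ^ 2 + c) ≤ u * √((b + x) ^ 2 + c) + v * √((b + y) ^ 2 + c) := by
  have hX : 0 ≤ (b + x) ^ 2 + c := by positivity
  have hY : 0 ≤ (b + y) ^ 2 + c := by positivity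
  have h1 := Real.sq_sqrt hX
  have h2 := Real.sq_sqrt hY
  set X := √((b + x) ^ 2 + c)
  set Y := √((b + y) ^ 2 + c)
  have hX0 : 0 ≤ X := Real.sqrt_nonneg _
  have hY0 : 0 ≤ Y := Real.sqrt_nonneg _
  have h3 : (b + x) * (b + y) + c ≤ X * Y := by
    refine le_of_sq_le_sq ?_ (by positivity)
    rw [mul_pow, h1, h2]
    nlinarith [mul_nonneg hc (sq_nonneg (x - y))]
  refine Real.sqrt_le_iff.2 ⟨by positivity, ?_⟩
  have h4 : b + (u * x + v * y) = u * (b + x) + v * (b + y) := by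
    linear_combination -b * huv
  have h5 : c = (u + v) ^ 2 * c := by rw [huv]; ring
  rw [h4]
  have h6 : (u * X + v * Y) ^ 2 - ((u * (b + x) + v * (b + y)) ^ 2 + c) =
      2 * (u * v * (X * Y - ((b + x) * (b + y) + c))) := by
    linear_combination u ^ 2 * h1 + v ^ 2 * h2 - h5
  have h7 := mul_nonneg (mul_nonneg hu hv) (sub_nonneg.2 h3)
  linarith

/-- The same argument; for `c > 0` and `x ≠ y` the two vectors are not parallel, so Cauchy–Schwarz
is strict. -/
theorem sqrt_sq_add_strict_convex {b c x y u v : ℝ} (hc : 0 < c) (hu : 0 < u) (hv : 0 < v)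
    (huv : u + v = 1) (hxy : x ≠ y) :
    √((b + (u * x + v * y)) ^ 2 + c) < u * √((b + x) ^ 2 + c) + v * √((b + y) ^ 2 + c) := by
  have hX : 0 < (b + x) ^ 2 + c := by positivity
  have hY : 0 < (b + y) ^ 2 + c := by positivity
  have h1 := Real.sq_sqrt hX.le
  have h2 := Real.sq_sqrt hY.le
  have hX0 := Real.sqrt_pos.2 hX
  have hY0 := Real.sqrt_pos.2 hY
  set X := √((b + x) ^ 2 + c)
  set Y := √((b + y) ^ 2 + c)
  have h3 : (b + x) * (b + y) + c < X * Y := by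
    refine lt_of_pow_lt_pow_left₀ 2 (by positivity) ?_
    rw [mul_pow, h1, h2]
    nlinarith [mul_pos hc (sq_pos_of_ne_zero (sub_ne_zero.2 hxy))]
  refine (Real.sqrt_lt' (by positivity)).2 ?_
  have h4 : b + (u * x + v * y) = u * (b + x) + v * (b + y) := by
    linear_combination -b * huv
  have h5 : c = (u + v) ^ 2 * c := by rw [huv]; ring
  rw [h4]
  have h6 : (u * X + v * Y) ^ 2 - ((u * (b + x) + v * (b + y)) ^ 2 + c) =
      2 * (u * v * (X * Y - ((b + x) * (b + y) + c))) := by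
    linear_combination u ^ 2 * h1 + v ^ 2 * h2 - h5
  have h7 := mul_pos (mul_pos hu hv) (sub_pos.2 h3)
  linarith

/-- A sum of two such functions, the first of which is strictly convex, takes each value at most
twice. -/
theorem countable_sqrt_add_sqrt_eq {b b' c c' : ℝ} (hc : 0 < c) (hc' : 0 ≤ c') (E : ℝ) :
    {τ : ℝ | √((b + τ) ^ 2 + c) + √((b' + τ) ^ 2 + c') = E}.Countable := by
  set f : ℝ → ℝ := fun τ => √((b + τ) ^ 2 + c) + √((b' + τ) ^ 2 + c') with hf
  have key : ∀ x y z : ℝ, x < y → y < z → f x = E → f y = E → f z = E → False := by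
    intro x y z hxy hyz hx hy hz
    have hxz : 0 < z - x := by linarith
    have huv : (z - y) / (z - x) + (y - x) / (z - x) = 1 := by field_simp; ring
    have hu : 0 < (z - y) / (z - x) := div_pos (by linarith) hxz
    have hv : 0 < (y - x) / (z - x) := div_pos (by linarith) hxz
    have hcomb : (z - y) / (z - x) * x + (y - x) / (z - x) * z = y := by field_simp; ring
    have h1 := sqrt_sq_add_strict_convex (b := b) hc hu hv huv (by linarith : x ≠ z)
    have h2 := sqrt_sq_add_convex (b := b') (x := x) (y := z) hc' hu.le hv.le huv
    rw [hcomb] at h1 h2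
    simp only [hf] at hx hy hz
    set u := (z - y) / (z - x)
    set v := (y - x) / (z - x)
    nlinarith [congrArg (u * ·) hx, congrArg (v * ·) hz, congrArg (E * ·) huv]
  change {τ | f τ = E}.Countable
  by_cases hsub : {τ | f τ = E}.Subsingleton
  · exact hsub.countable
  · obtain ⟨x, hx, y, hy, hxy⟩ : ∃ x, f x = E ∧ ∃ y, f y = E ∧ x < y := by
      rw [Set.not_subsingleton_iff] at hsub
      obtain ⟨x, hx, y, hy, hne⟩ := hsub
      rcases lt_or_gt_of_ne hne with h | h
      · exact ⟨x, hx, y, hy, h⟩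
      · exact ⟨y, hy, x, hx, h⟩
    refine (Set.to_countable {x, y}).mono fun z hz => ?_
    by_contra hne
    simp only [Set.mem_insert_iff, Set.mem_singleton_iff, not_or] at hne
    rcases lt_or_gt_of_ne hne.1 with h | h
    · exact key z x y h hxy hz hx hy
    · rcases lt_or_gt_of_ne hne.2 with h' | h'
      · exact key x z y h h' hx hz hy
      · exact key x y z hxy h' hx hy hz

theorem sum_single_sub_single {n : ℕ} {M : Type*} [AddCommGroup M] (r t : Fin n) (v : M) :
    ∑ l, (Pi.single r v - Pi.single t v : Fin n → M) l = 0 := by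
  simp [Finset.sum_sub_distrib]

theorem ae_full_apply_ne_zero {n s : ℕ} (hn : 2 ≤ n) (i l : Fin n) (a : Fin s) :
    ∀ᵐ p : OtherMomenta s i, full i p l a ≠ 0 := by
  let L : OtherMomenta s i →ₗ[ℝ] ℝ := LinearMap.proj a ∘ₗ LinearMap.proj l ∘ₗ full i
  have h := Measure.addHaar_submodule (volume : Measure (OtherMomenta s i)) (LinearMap.ker L) (by
    intro htop
    have : Nontrivial (Fin n) := Fin.nontrivial_iff_two_le.2 hn
    obtain ⟨t, ht⟩ := exists_ne l
    -- A family of vanishing sum whose `a`-th component at `l` is `1`, so the linear functional `L`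
    -- is not zero and its kernel is null.
    let q : Fin n → Fin s → ℝ := Pi.single l (Pi.single a 1) - Pi.single t (Pi.single a 1)
    have hq : ∑ l, q l = 0 := sum_single_sub_single l t _
    have h0 : others i q ∈ LinearMap.ker L := by rw [htop]; trivial
    have h1 : full i (others i q) l a = 0 := h0
    rw [full_others i hq] at h1
    simp [q, ht.symm] at h1)
  exact measure_eq_zero_iff_ae_notMem.1 h

theorem energy_pos_of_ne_zero {s : ℕ} (m : ℝ) {p : Fin s → ℝ} {a : Fin s} (h : p a ≠ 0) :
    0 < energy m p := (abs_pos.2 h).trans_le (abs_le_energy m p a)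

theorem energy_eq_sqrt {s : ℕ} (m : ℝ) (p : Fin s → ℝ) (a : Fin s) :
    energy m p = √(p a ^ 2 + (∑ b ∈ Finset.univ.erase a, p b ^ 2 + m ^ 2)) := by
  rw [energy, ← Finset.add_sum_erase _ (fun b => p b ^ 2) (Finset.mem_univ a), add_assoc]

/-- Moving momentum `τ` from particle `t` to particle `r` in direction `a` keeps the total zero. If
both particles carry the same sign in `B_j`, the variable part is, up to that sign, a sum of two
convex functions of `τ`. -/
theorem signedEnergy_line {n s : ℕ} (m : Fin n → ℝ) {j : ℕ} {r t : Fin n} (hrt : r ≠ t)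
    (hj : (r : ℕ) < j ↔ (t : ℕ) < j) (a : Fin s) (q : Fin n → Fin s → ℝ) :
    ∃ K σ : ℝ, σ ≠ 0 ∧ ∀ τ : ℝ,
      signedEnergy m (q + τ • (Pi.single r (Pi.single a 1) - Pi.single t (Pi.single a 1) :
        Fin n → Fin s → ℝ)) j =
      K + σ * (√((q r a + τ) ^ 2 + (∑ b ∈ Finset.univ.erase a, q r b ^ 2 + m r ^ 2)) +
        √((-q t a + τ) ^ 2 + (∑ b ∈ Finset.univ.erase a, q t b ^ 2 + m t ^ 2))) := by
  refine ⟨∑ l ∈ (Finset.univ.erase r).erase t,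
    (if (l : ℕ) < j then energy (m l) (q l) else -energy (m l) (q l)),
    if (r : ℕ) < j then 1 else -1, by split_ifs <;> norm_num, fun τ => ?_⟩
  have ht : t ∈ Finset.univ.erase r := by simp [hrt.symm]
  set d : Fin n → Fin s → ℝ := Pi.single r (Pi.single a 1) - Pi.single t (Pi.single a 1) with hd
  unfold signedEnergy
  rw [← Finset.add_sum_erase _ _ (Finset.mem_univ r), ← Finset.add_sum_erase _ _ ht]
  have er : energy (m r) ((q + τ • d) r) =
      √((q r a + τ) ^ 2 + (∑ b ∈ Finset.univ.erase a, q r b ^ 2 + m r ^ 2)) := by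
    rw [energy_eq_sqrt _ _ a]
    congr 2
    · simp [d, hrt]
    · congr 1
      refine Finset.sum_congr rfl fun b hb => ?_
      simp [d, hrt, Finset.ne_of_mem_erase hb]
  have et : energy (m t) ((q + τ • d) t) =
      √((-q t a + τ) ^ 2 + (∑ b ∈ Finset.univ.erase a, q t b ^ 2 + m t ^ 2)) := by
    rw [energy_eq_sqrt _ _ a]
    congr 2
    · simp [d, hrt.symm]; ring
    · congr 1
      refine Finset.sum_congr rfl fun b hb => ?_
      simp [d, hrt.symm, Finset.ne_of_mem_erase hb]
  have eo : ∑ l ∈ (Finset.univ.erase r).erase t, (if (l : ℕ) < j then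
      energy (m l) ((q + τ • d) l)
      else -energy (m l)
        ((q + τ • d) l)) =
      ∑ l ∈ (Finset.univ.erase r).erase t,
        if (l : ℕ) < j then energy (m l) (q l) else -energy (m l) (q l) := by
    refine Finset.sum_congr rfl fun l hl => ?_
    have h1 : l ≠ t := Finset.ne_of_mem_erase hl
    have h2 : l ≠ r := Finset.ne_of_mem_erase (Finset.mem_of_mem_erase hl)
    have : (q + τ • d) l = q l := by
      simp [d, h1, h2]
    rw [this]
  rw [er, et, eo]
  by_cases h : (r : ℕ) < j
  · simp only [h, hj.1 h, if_true]; ring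
  · have h' : ¬(t : ℕ) < j := fun h2 => h (hj.2 h2)
    simp only [h, h', if_false]; ring

/-- On almost every line of the kind in `signedEnergy_line` the zeros are countable by strict
convexity, and Fubini over the lines makes the zero set null. -/
theorem ae_signedEnergy_ne_zero {n s : ℕ} (hn : 3 ≤ n) (hs : 1 ≤ s) (m : Fin n → ℝ)
    (hm : s ≤ 2 → ∀ l, 0 < m l) (i : Fin n) (j : ℕ) :
    ∀ᵐ p : OtherMomenta s i, signedEnergy m (full i p) j ≠ 0 := by
  -- Of three particles two lie on the same side of `j`: the pair 0, 1 if `j > 1`, and 1, 2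
  -- otherwise.
  obtain ⟨r, t, hrt, hj⟩ : ∃ r t : Fin n, r ≠ t ∧ ((r : ℕ) < j ↔ (t : ℕ) < j) := by
    by_cases h : 1 < j
    · exact ⟨⟨0, by omega⟩, ⟨1, by omega⟩, by simp, by simp; omega⟩
    · exact ⟨⟨1, by omega⟩, ⟨2, by omega⟩, by simp, by simp; omega⟩
  let a : Fin s := ⟨0, hs⟩
  let c : (Fin n → Fin s → ℝ) → ℝ := fun q => ∑ b ∈ Finset.univ.erase a, q r b ^ 2 + m r ^ 2
  have hcfull := (full (s := s) i).continuous_of_finiteDimensional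
  have hc : ∀ᵐ p : OtherMomenta s i, c (full i p) ≠ 0 := by
    by_cases hs2 : s ≤ 2
    · refine Eventually.of_forall fun p => ?_
      have := hm hs2 r
      positivity
    · let b : Fin s := ⟨1, by omega⟩
      filter_upwards [ae_full_apply_ne_zero (by omega) i r b] with p hp
      have h1 : 0 < full i p r b ^ 2 := by positivity
      have h2 : b ∈ Finset.univ.erase a := by simp [a, b]
      have h3 := Finset.single_le_sum (f := fun b => full i p r b ^ 2) (fun _ _ => sq_nonneg _) h2
      have : 0 < c (full i p) :=
        add_pos_of_pos_of_nonneg (h1.trans_le h3) (sq_nonneg _)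
      exact this.ne'
  let d : Fin n → Fin s → ℝ := Pi.single r (Pi.single a 1) - Pi.single t (Pi.single a 1)
  have hd : ∑ l, d l = 0 := sum_single_sub_single r t _
  -- Strict convexity needs `c > 0`. As `c` is constant along each line, the alternative `c = 0` is
  -- admitted here so that every line can be treated, and is discarded at the end with `hc`.
  have hS : MeasurableSet
      {p : OtherMomenta s i | signedEnergy m (full i p) j ≠ 0 ∨ c (full i p) = 0} := by
    have h1 : Continuous fun p : OtherMomenta s i => signedEnergy m (full i p) j :=
      (continuous_signedEnergy m j).comp hcfull
    have h2 : Continuous fun p : OtherMomenta s i => c (full i p) :=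
      Continuous.comp (g := c) (by fun_prop) hcfull
    exact (measurableSet_singleton 0).compl.preimage h1.measurable |>.union
      ((measurableSet_singleton 0).preimage h2.measurable)
  have h := ae_mem_of_ae_add_linearMap_mem
    (LinearMap.toSpanSingleton ℝ (OtherMomenta s i) (others i d)) (volume : Measure ℝ)
    (volume : Measure (OtherMomenta s i)) hS (fun p => by
      have hline : ∀ τ : ℝ, full i (p + LinearMap.toSpanSingleton ℝ _ (others i d) τ) =
          full i p + τ • d := by
        intro τ
        rw [map_add, LinearMap.toSpanSingleton_apply, map_smul, full_others i hd]
      have hcline : ∀ τ : ℝ, c (full i p + τ • d) = c (full i p) := by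
        intro τ
        simp only [c]
        congr 1
        refine Finset.sum_congr rfl fun b hb => ?_
        simp [d, hrt, Finset.ne_of_mem_erase hb]
      by_cases hp : c (full i p) = 0
      · refine Eventually.of_forall fun τ => Or.inr ?_
        rw [hline, hcline, hp]
      · obtain ⟨K, σ, hσ, hK⟩ := signedEnergy_line m hrt hj a (full i p)
        have hcpos : 0 < c (full i p) :=
          lt_of_le_of_ne (by positivity) (Ne.symm hp)
        have hcount := (countable_sqrt_add_sqrt_eq (b := full i p r a) (b' := -full i p t a)
          hcpos (c' := ∑ b ∈ Finset.univ.erase a, full i p t b ^ 2 + m t ^ 2)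
          (by positivity) (-K / σ)).ae_notMem volume
        filter_upwards [hcount] with τ hτ
        refine Or.inl ?_
        rw [hline, hK τ]
        intro h0
        refine hτ ?_
        refine (eq_div_iff hσ).2 ?_
        linear_combination h0)
  filter_upwards [h, hc] with p h1 h2
  exact h1.resolve_right h2

/-! ### Functions with bounds in the space momenta -/

/-- The space part of the `l`-th momentum. -/
def space {n s : ℕ} (k : Config n s) (l : Fin n) : Fin s → ℝ := fun a => k (l, a.succ)

/-- Continuous functions of the momenta that are bounded by `C ∏_l decay (\vec k_l)`, together with
their difference quotients in the energies. -/
structure HasBound {n s : ℕ} (g : Config n s → ℂ) (C : ℝ) : Prop where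
  continuous : Continuous g
  norm_le : ∀ k, ‖g k‖ ≤ C * ∏ l, decay (space k l)
  norm_sub_le : ∀ (k k' : Config n s) (b : ℝ), 0 ≤ b → space k = space k' → (∀ i, |k i - k' i| ≤ b) →
    ‖g k - g k'‖ ≤ C * (∏ l, decay (space k l)) * b

theorem HasBound.nonneg {n s : ℕ} {g : Config n s → ℂ} {C : ℝ} (hg : HasBound g C) : 0 ≤ C := by
  have h := (norm_nonneg _).trans (hg.norm_le 0)
  exact nonneg_of_mul_nonneg_left h (Finset.prod_pos fun l _ => decay_pos _)

/-! ### The summed integrand and its majorant -/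

/-- The sum of the integrands of `\hat G_n(g)` in terms of all the space momenta. -/
def cutIntegrand {n s : ℕ} (m : Fin n → ℝ) (η : ℝ) (g : Config n s → ℂ) (q : Fin n → Fin s → ℝ) :
    ℂ :=
  ∑ j : Fin n, (((∏ l : {l : Fin n // l ≠ j}, 1 / (2 * energy (m l) (others j q l))) *
    cutPropagator η (m j) (momenta m j (others j q) j) : ℝ) : ℂ) *
      g (toConfig (momenta m j (others j q)))

theorem cutIntegrand_add {n s : ℕ} (m : Fin n → ℝ) (η : ℝ) (g h : Config n s → ℂ)
    (q : Fin n → Fin s → ℝ) :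
    cutIntegrand m η (fun k => g k + h k) q = cutIntegrand m η g q + cutIntegrand m η h q := by
  simp only [cutIntegrand, mul_add, Finset.sum_add_distrib]

theorem cutIntegrand_const_mul {n s : ℕ} (m : Fin n → ℝ) (η : ℝ) (c : ℂ) (g : Config n s → ℂ)
    (q : Fin n → Fin s → ℝ) :
    cutIntegrand m η (fun k => c * g k) q = c * cutIntegrand m η g q := by
  simp only [cutIntegrand, Finset.mul_sum]
  exact Finset.sum_congr rfl fun j _ => by ring

/-- An integrable function dominating all the integrands. -/
def dominator {n s : ℕ} (m : Fin n → ℝ) (q : Fin n → Fin s → ℝ) : ℝ :=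
  ∑ t : Fin n, ∏ l : {l : Fin n // l ≠ t}, (1 + 1 / (2 * energy (m l) (q l))) ^ 2 * decay (q l)

theorem integrable_prod_weight {n s : ℕ} {m : Fin n → ℝ} (hm : ∀ l, 0 ≤ m l)
    (hm' : s ≤ 2 → ∀ l, 0 < m l) (t : Fin n) :
    Integrable fun p : OtherMomenta s t => ∏ l : {l : Fin n // l ≠ t},
      (1 + 1 / (2 * energy (m l) (p l))) ^ 2 * decay (p l) :=
  Integrable.fintype_prod (f := fun (l : {l : Fin n // l ≠ t}) (p : Fin s → ℝ) =>
    (1 + 1 / (2 * energy (m l) p)) ^ 2 * decay p)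
    fun l => integrable_particle_weight (hm l) fun h => hm' h l

theorem integrable_dominator {n s : ℕ} {m : Fin n → ℝ} (hm : ∀ l, 0 ≤ m l)
    (hm' : s ≤ 2 → ∀ l, 0 < m l) (i : Fin n) :
    Integrable fun p : OtherMomenta s i => dominator m (full i p) :=
  integrable_finsetSum _ fun t _ =>
    (measurePreserving_others_full i t).integrable_comp_of_integrable
      (integrable_prod_weight hm hm' t)

theorem space_toConfig {n s : ℕ} (m : Fin n → ℝ) (j : Fin n) {q : Fin n → Fin s → ℝ}
    (hq : ∑ l, q l = 0) : space (toConfig (momenta m j (others j q))) = q := by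
  funext l a
  simp [space, toConfig, momenta_others m j hq]

theorem toConfig_zero {n s : ℕ} (m : Fin n → ℝ) (j : Fin n) {q : Fin n → Fin s → ℝ}
    (hq : ∑ l, q l = 0) (l : Fin n) :
    toConfig (momenta m j (others j q)) (l, 0) = shellTime m j q l := by
  simp [toConfig, momenta_others m j hq]

/-- The energy of `k_j` passes from `B_j + ω_j` to `-ω_j`, that of `k_{j+1}` from `ω_{j+1}` to
`B_{j+1} + ω_{j+1}`; all else is unchanged. -/
theorem abs_toConfig_sub_le {n s : ℕ} (m : Fin n → ℝ) {j j' : Fin n} (hj : (j' : ℕ) = j + 1)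
    {q : Fin n → Fin s → ℝ} (hq : ∑ l, q l = 0) (i : Fin n × Fin (s + 1)) :
    |toConfig (momenta m j' (others j' q)) i - toConfig (momenta m j (others j q)) i| ≤
      |signedEnergy m q (j + 1)| := by
  obtain ⟨l, μ⟩ := i
  refine Fin.cases ?_ (fun a => ?_) μ
  · rw [toConfig_zero m j' hq, toConfig_zero m j hq]
    have h1 := signedEnergy_succ m q j
    have hne : j ≠ j' := fun h => by simp [h] at hj
    unfold shellTime
    by_cases h : l = j
    · subst h
      have hlt : l < j' := Fin.lt_def.2 (by omega)
      rw [if_neg hne, if_pos hlt, if_pos rfl, abs_sub_comm, h1]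
      exact le_of_eq (congrArg _ (by ring))
    · by_cases h' : l = j'
      · subst h'
        have hlt : ¬l < j := fun h => by have := Fin.lt_def.1 h; omega
        rw [if_pos rfl, if_neg h, if_neg hlt, hj, add_sub_cancel_right]
      · have : l < j' ↔ l < j := by
          have := Fin.val_ne_of_ne h
          simp only [Fin.lt_def]; omega
        simp only [h, h', this, if_false, sub_self, abs_zero]
        exact abs_nonneg _
  · have h1 := congrFun (congrFun (space_toConfig m j' hq) l) a
    have h2 := congrFun (congrFun (space_toConfig m j hq) l) a
    have : toConfig (momenta m j' (others j' q)) (l, a.succ) =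
      toConfig (momenta m j (others j q)) (l, a.succ) := h1.trans h2.symm
    rw [this, sub_self, abs_zero]
    exact abs_nonneg _

theorem norm_cutIntegrand_le {n s : ℕ} (hn : 3 ≤ n) (m : Fin n → ℝ) {η : ℝ} (hη : 0 ≤ η)
    {g : Config n s → ℂ} {C : ℝ} (hg : HasBound g C) {q : Fin n → Fin s → ℝ}
    (hq : ∑ l, q l = 0) (hpos : ∀ l, 0 < energy (m l) (q l)) :
    ‖cutIntegrand m η g q‖ ≤ 6 * n * C * dominator m q := by
  set P : ℝ := ∏ l, 1 / (2 * energy (m l) (q l)) with hP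
  set w : ℝ := C * ∏ l, decay (q l) with hw
  have hdec : 0 ≤ ∏ l, decay (q l) := Finset.prod_nonneg fun l _ => (decay_pos _).le
  have hw0 : 0 ≤ w := mul_nonneg hg.nonneg hdec
  have hP0 : 0 ≤ P := Finset.prod_nonneg fun l _ => by have := hpos l; positivity
  let B : ℕ → ℝ := signedEnergy m q
  -- Extended by `0` beyond `n` to fit `norm_sum_cut_mul_le`; these default values are never used.
  let E : ℕ → ℝ := fun j => if h : j < n then energy (m ⟨j, h⟩) (q ⟨j, h⟩) else 0
  let G : ℕ → ℂ := fun j =>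
    if h : j < n then g (toConfig (momenta m ⟨j, h⟩ (others ⟨j, h⟩ q))) else 0
  have hE : ∀ (j : ℕ) (h : j < n), E j = energy (m ⟨j, h⟩) (q ⟨j, h⟩) := fun j h => dif_pos h
  have hG : ∀ (j : ℕ) (h : j < n), G j = g (toConfig (momenta m ⟨j, h⟩ (others ⟨j, h⟩ q))) :=
    fun j h => dif_pos h
  have hS0 : 0 ≤ ∑ l, energy (m l) (q l) := Finset.sum_nonneg fun l _ => energy_nonneg _ _
  have hle : ∀ (j : ℕ), j < n → E j ≤ ∑ l, energy (m l) (q l) := fun j h => by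
    rw [hE j h]
    exact Finset.single_le_sum (f := fun l => energy (m l) (q l))
      (fun l _ => energy_nonneg _ _) (Finset.mem_univ _)
  have hsum : cutIntegrand m η g q = P * ∑ j ∈ Finset.range n,
      ((if η < |B j| ∧ η < |B (j + 1)| then 1 / B j - 1 / B (j + 1) else 0 : ℝ) : ℂ) * G j := by
    rw [Finset.mul_sum, ← Fin.sum_univ_eq_sum_range (fun j => (P : ℂ) *
      (((if η < |B j| ∧ η < |B (j + 1)| then 1 / B j - 1 / B (j + 1) else 0 : ℝ) : ℂ) * G j))]
    refine Finset.sum_congr rfl fun j _ => ?_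
    rw [prod_mul_cutPropagator m hη j hq (hpos j), Complex.ofReal_mul, mul_assoc, hG j j.2]
  have hbound := norm_sum_cut_mul_le (n := n) (by omega) (B := B) (E := E) (G := G) hη hw0 hw0
    (fun j h => by rw [hE j h]; exact hpos _)
    (fun j h => by rw [hE j h]; exact signedEnergy_succ m q ⟨j, h⟩)
    (by
      change E 0 ≤ |signedEnergy m q 0|
      rw [signedEnergy_zero, abs_neg, abs_of_nonneg hS0]
      exact hle 0 (by omega))
    (by
      change E (n - 1) ≤ |signedEnergy m q n|
      rw [signedEnergy_last, abs_of_nonneg hS0]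
      exact hle (n - 1) (by omega))
    (fun j h => by
      rw [hG j h]
      refine (hg.norm_le _).trans_eq ?_
      rw [space_toConfig m _ hq])
    (fun j h => by
      rw [hG j (by omega), hG (j + 1) h]
      refine (hg.norm_sub_le _ _ (|B (j + 1)|) (abs_nonneg _)
        ((space_toConfig m _ hq).trans (space_toConfig m _ hq).symm)
        (abs_toConfig_sub_le m (j := ⟨j, by omega⟩) (j' := ⟨j + 1, h⟩) rfl hq)).trans_eq ?_
      rw [space_toConfig m _ hq])
  have hEsum : ∑ j ∈ Finset.range n, 1 / E j = ∑ l, 2 * (1 / (2 * energy (m l) (q l))) := by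
    rw [← Fin.sum_univ_eq_sum_range (fun j => 1 / E j)]
    refine Finset.sum_congr rfl fun l _ => ?_
    rw [hE l l.2]
    have := (hpos l).ne'
    field_simp
  rw [hEsum, ← Finset.mul_sum] at hbound
  have hSa : 0 ≤ ∑ l, 1 / (2 * energy (m l) (q l)) :=
    Finset.sum_nonneg fun l _ => by have := hpos l; positivity
  have hprod : ∀ i, P * (1 + 1 / (2 * energy (m i) (q i))) * ∏ l, decay (q l) ≤ dominator m q := by
    intro i
    have h1 := prod_mul_one_add_le_sum_prod hn (a := fun l => 1 / (2 * energy (m l) (q l)))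
      (fun l => by have := hpos l; positivity) i
    refine (mul_le_mul_of_nonneg_right h1 hdec).trans ?_
    rw [Finset.sum_mul]
    refine Finset.sum_le_sum fun t _ => ?_
    rw [Finset.prod_mul_distrib, prod_eq_mul_prod_ne t fun l => decay (q l)]
    refine mul_le_mul_of_nonneg_left ?_ (Finset.prod_nonneg fun l _ => sq_nonneg _)
    exact mul_le_of_le_one_left (Finset.prod_nonneg fun l _ => (decay_pos _).le) (decay_le_one _)
  have hn1 : ∑ i : Fin n, (1 + 1 / (2 * energy (m i) (q i))) =
      n + ∑ i, 1 / (2 * energy (m i) (q i)) := by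
    simp [Finset.sum_add_distrib]
  rw [hsum, norm_mul, Complex.norm_real, Real.norm_of_nonneg hP0]
  -- The 6 is the 3 of the summation by parts times the 2 in `1/ω = 2 · 1/(2ω)`; the `n` counts the
  -- indices `i`, each estimated by `hprod`.
  calc P * _ ≤ P * (n * w + 3 * w * (2 * ∑ l, 1 / (2 * energy (m l) (q l)))) := by gcongr
    _ ≤ P * (6 * w * ∑ i : Fin n, (1 + 1 / (2 * energy (m i) (q i)))) := by
        rw [hn1]
        have : (0 : ℝ) ≤ n * w := by positivity
        gcongr
        nlinarith
    _ = 6 * C * ∑ i, P * (1 + 1 / (2 * energy (m i) (q i))) * ∏ l, decay (q l) := by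
        rw [hw, ← Finset.sum_mul, ← Finset.mul_sum]; ring
    _ ≤ 6 * C * ∑ _i : Fin n, dominator m q := by
        have := hg.nonneg
        gcongr with i
        exact hprod i
    _ = _ := by simp; ring

/-! ### Integrability and limits of the integrands -/

@[fun_prop] theorem continuous_onShell {s : ℕ} (m sign : ℝ) :
    Continuous fun p : Fin s → ℝ => onShell m sign p := by
  refine continuous_pi fun μ => Fin.cases ?_ (fun a => ?_) μ
  · simp only [onShell, Fin.cons_zero]; fun_prop
  · simp only [onShell, Fin.cons_succ]; fun_prop

theorem continuous_momenta {n s : ℕ} (m : Fin n → ℝ) (j : Fin n) :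
    Continuous fun p : OtherMomenta s j => momenta m j p := by
  refine continuous_pi fun l => ?_
  unfold momenta
  split_ifs with h
  · exact (continuous_finsetSum _ fun i _ =>
      (continuous_onShell _ _).comp (continuous_apply i)).neg
  · exact (continuous_onShell _ _).comp (continuous_apply _)
  · exact (continuous_onShell _ _).comp (continuous_apply _)

theorem continuous_toConfig {n s : ℕ} :
    Continuous fun k : Fin n → Fin (s + 1) → ℝ => (toConfig k : Config n s) := by
  unfold toConfig
  refine (PiLp.continuous_toLp 2 _).comp ?_
  fun_prop

theorem measurable_cutPropagator {s : ℕ} (η m : ℝ) :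
    Measurable fun k : Fin (s + 1) → ℝ => cutPropagator η m k := by
  have hsp : Continuous fun k : Fin (s + 1) → ℝ => spatial k := by unfold spatial; fun_prop
  have he : Continuous fun k : Fin (s + 1) → ℝ => energy m (spatial k) :=
    (continuous_energy m).comp hsp
  have hsq : Continuous fun k : Fin (s + 1) → ℝ => minkowskiSq k := by
    unfold minkowskiSq spatial; fun_prop
  unfold cutPropagator
  refine Measurable.ite ?_ ((hsq.sub continuous_const).measurable.const_div 1) measurable_const
  exact (measurableSet_lt measurable_const ((continuous_apply 0).sub he).abs.measurable).inter
    (measurableSet_lt measurable_const ((continuous_apply 0).add he).abs.measurable)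

theorem measurable_summand {n s : ℕ} (m : Fin n → ℝ) (η : ℝ) {g : Config n s → ℂ}
    (hg : Continuous g) (j : Fin n) :
    Measurable fun p : OtherMomenta s j =>
      (((∏ l : {l : Fin n // l ≠ j}, 1 / (2 * energy (m l) (p l))) *
        cutPropagator η (m j) (momenta m j p j) : ℝ) : ℂ) * g (toConfig (momenta m j p)) := by
  have h1 : Measurable fun p : OtherMomenta s j => cutPropagator η (m j) (momenta m j p j) :=
    (measurable_cutPropagator η (m j)).comp
      ((continuous_apply j).comp (continuous_momenta m j)).measurable
  have h2 : Measurable fun p : OtherMomenta s j => g (toConfig (momenta m j p)) :=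
    (hg.comp (continuous_toConfig.comp (continuous_momenta m j))).measurable
  have h3 : Measurable fun p : OtherMomenta s j =>
      ∏ l : {l : Fin n // l ≠ j}, 1 / (2 * energy (m l) (p l)) :=
    Finset.measurable_prod _ fun l _ =>
      (((continuous_energy (m l)).measurable.comp (measurable_pi_apply l)).const_mul 2).const_div 1
  exact (Complex.measurable_ofReal.comp (h3.mul h1)).mul h2

theorem measurable_cutIntegrand {n s : ℕ} (m : Fin n → ℝ) (η : ℝ) {g : Config n s → ℂ}
    (hg : Continuous g) (i : Fin n) :
    Measurable fun p : OtherMomenta s i => cutIntegrand m η g (full i p) :=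
  Finset.measurable_sum _ fun j _ =>
    (measurable_summand m η hg j).comp (measurePreserving_others_full i j).measurable

theorem abs_cutPropagator_le {s : ℕ} {η : ℝ} (hη : 0 < η) (m : ℝ) (k : Fin (s + 1) → ℝ) :
    |cutPropagator η m k| ≤ 1 / η ^ 2 := by
  unfold cutPropagator
  split_ifs with h
  · have : minkowskiSq k - m ^ 2 =
        (k 0 - energy m (spatial k)) * (k 0 + energy m (spatial k)) := by
      unfold minkowskiSq
      linear_combination sq_energy m (spatial k)
    rw [this, abs_div, abs_one, abs_mul, sq]
    gcongr
    · exact h.1.le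
    · exact h.2.le
  · simp; positivity

/-- For fixed `η > 0` the cut propagator is at most `1/η²`, so each summand is integrable by itself.
A bound uniform in `η` is obtained only for the sum. -/
theorem integrable_summand {n s : ℕ} {m : Fin n → ℝ} (hm : ∀ l, 0 ≤ m l)
    (hm' : s ≤ 2 → ∀ l, 0 < m l) {η : ℝ} (hη : 0 < η) {g : SchwartzMap (Config n s) ℂ} {C : ℝ}
    (hg : HasBound g C) (j : Fin n) : Integrable (summand m η g j) := by
  refine ((integrable_prod_weight hm hm' j).const_mul (1 / η ^ 2 * C)).mono'
    (measurable_summand m η hg.continuous j).aestronglyMeasurable (Eventually.of_forall fun p => ?_)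
  have h0 : ∀ l : {l : Fin n // l ≠ j}, 0 ≤ 1 / (2 * energy (m l) (p l)) := fun l => by
    have := energy_nonneg (m l) (p l); positivity
  have h1 := hg.norm_le (toConfig (momenta m j p))
  have hq := sum_full j p
  have h2 := space_toConfig m j hq
  rw [others_full] at h2
  rw [h2, prod_eq_mul_prod_ne j] at h1
  have h3 : ∏ l : {l : Fin n // l ≠ j}, decay (full j p l) =
      ∏ l : {l : Fin n // l ≠ j}, decay (p l) :=
    Finset.prod_congr rfl fun l _ => by rw [full_of_ne l.2]
  rw [h3] at h1
  have hd : 0 ≤ ∏ l : {l : Fin n // l ≠ j}, decay (p l) :=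
    Finset.prod_nonneg fun l _ => (decay_pos _).le
  have h4 : ‖g (toConfig (momenta m j p))‖ ≤ C * ∏ l : {l : Fin n // l ≠ j}, decay (p l) := by
    refine h1.trans (mul_le_mul_of_nonneg_left ?_ hg.nonneg)
    exact mul_le_of_le_one_left hd (decay_le_one _)
  have hC := hg.nonneg
  rw [summand, norm_mul, Complex.norm_real, norm_mul, Real.norm_eq_abs (cutPropagator _ _ _),
    Real.norm_of_nonneg (Finset.prod_nonneg fun l _ => h0 l), Finset.prod_mul_distrib]
  have h5 : ∏ l : {l : Fin n // l ≠ j}, 1 / (2 * energy (m l) (p l)) ≤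
      ∏ l : {l : Fin n // l ≠ j}, (1 + 1 / (2 * energy (m l) (p l))) ^ 2 :=
    Finset.prod_le_prod (fun l _ => h0 l) fun l _ => by nlinarith [h0 l]
  have h6 := Finset.prod_nonneg fun (l : {l : Fin n // l ≠ j}) (_ : l ∈ Finset.univ) => h0 l
  calc _ ≤ (∏ l : {l : Fin n // l ≠ j}, (1 + 1 / (2 * energy (m l) (p l))) ^ 2) * (1 / η ^ 2) *
        (C * ∏ l : {l : Fin n // l ≠ j}, decay (p l)) := by
        gcongr
        exact abs_cutPropagator_le hη _ _
    _ = _ := by ring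

theorem ae_energy_pos {n s : ℕ} (hn : 2 ≤ n) (hs : 1 ≤ s) (m : Fin n → ℝ) (i : Fin n) :
    ∀ᵐ p : OtherMomenta s i, ∀ l, 0 < energy (m l) (full i p l) :=
  ae_all_iff.2 fun l => (ae_full_apply_ne_zero hn i l ⟨0, hs⟩).mono
    fun _ hp => energy_pos_of_ne_zero _ hp

theorem ae_norm_cutIntegrand_le {n s : ℕ} (hn : 3 ≤ n) (hs : 1 ≤ s) (m : Fin n → ℝ) {η : ℝ}
    (hη : 0 ≤ η) {g : Config n s → ℂ} {C : ℝ} (hg : HasBound g C) (i : Fin n) :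
    ∀ᵐ p : OtherMomenta s i,
      ‖cutIntegrand m η g (full i p)‖ ≤ 6 * n * C * dominator m (full i p) :=
  (ae_energy_pos (by omega) hs m i).mono fun p hp =>
    norm_cutIntegrand_le hn m hη hg (sum_full i p) hp

theorem integrable_cutIntegrand {n s : ℕ} (hn : 3 ≤ n) (hs : 1 ≤ s) {m : Fin n → ℝ}
    (hm : ∀ l, 0 ≤ m l) (hm' : s ≤ 2 → ∀ l, 0 < m l) {η : ℝ} (hη : 0 ≤ η)
    {g : Config n s → ℂ} {C : ℝ} (hg : HasBound g C) (i : Fin n) :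
    Integrable fun p : OtherMomenta s i => cutIntegrand m η g (full i p) :=
  ((integrable_dominator hm hm' i).const_mul (6 * n * C)).mono'
    (measurable_cutIntegrand m η hg.continuous i).aestronglyMeasurable
    (ae_norm_cutIntegrand_le hn hs m hη hg i)

theorem norm_integral_cutIntegrand_le {n s : ℕ} (hn : 3 ≤ n) (hs : 1 ≤ s) {m : Fin n → ℝ}
    (hm : ∀ l, 0 ≤ m l) (hm' : s ≤ 2 → ∀ l, 0 < m l) {η : ℝ} (hη : 0 ≤ η)
    {g : Config n s → ℂ} {C : ℝ} (hg : HasBound g C) (i : Fin n) :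
    ‖∫ p : OtherMomenta s i, cutIntegrand m η g (full i p)‖ ≤
      6 * n * C * ∫ p : OtherMomenta s i, dominator m (full i p) := by
  rw [← integral_const_mul]
  exact norm_integral_le_of_norm_le ((integrable_dominator hm hm' i).const_mul (6 * n * C))
    (ae_norm_cutIntegrand_le hn hs m hη hg i)

/-- The summands live on different coordinate spaces; the measure preserving changes of coordinates
bring all of them to `q_l`, `l ≠ i`, where they can cancel pointwise. -/
theorem sum_integral_summand {n s : ℕ} (m : Fin n → ℝ) (η : ℝ) (g : SchwartzMap (Config n s) ℂ)
    (h : ∀ j, Integrable (summand m η g j)) (i : Fin n) :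
    ∑ j, ∫ p, summand m η g j p = ∫ p : OtherMomenta s i, cutIntegrand m η g (full i p) := by
  unfold cutIntegrand
  rw [integral_finsetSum]
  · refine Finset.sum_congr rfl fun j _ => ?_
    have hmp := measurePreserving_others_full (s := s) i j
    rw [← hmp.map_eq, integral_map hmp.measurable.aemeasurable]
    · rfl
    · rw [hmp.map_eq]; exact (h j).aestronglyMeasurable
  · exact fun j _ => (measurePreserving_others_full i j).integrable_comp_of_integrable (h j)

theorem tendsto_integral_cutIntegrand {n s : ℕ} (hn : 3 ≤ n) (hs : 1 ≤ s) {m : Fin n → ℝ}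
    (hm : ∀ l, 0 ≤ m l) (hm' : s ≤ 2 → ∀ l, 0 < m l)
    {g : Config n s → ℂ} {C : ℝ} (hg : HasBound g C) (i : Fin n) :
    Tendsto (fun η : ℝ => ∫ p : OtherMomenta s i, cutIntegrand m η g (full i p)) (𝓝[>] 0)
      (𝓝 (∫ p : OtherMomenta s i, cutIntegrand m 0 g (full i p))) := by
  refine tendsto_integral_filter_of_dominated_convergence
    (fun p => 6 * n * C * dominator m (full i p))
    (Eventually.of_forall fun η =>
      (measurable_cutIntegrand m η hg.continuous i).aestronglyMeasurable)
    (eventually_nhdsWithin_of_forall fun η (hη : 0 < η) =>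
      ae_norm_cutIntegrand_le hn hs m hη.le hg i)
    ((integrable_dominator hm hm' i).const_mul _) ?_
  have hne : ∀ᵐ p : OtherMomenta s i, ∀ j : ℕ, signedEnergy m (full i p) j ≠ 0 :=
    ae_all_iff.2 fun j => ae_signedEnergy_ne_zero hn hs m hm' i j
  filter_upwards [hne] with p hp
  -- Where no `B_j` vanishes, the integrand no longer depends on `η` once `η` is below all `|B_j|`,
  -- `j ≤ n`.
  refine tendsto_const_nhds.congr' ?_
  have hsmall : ∀ j : ℕ, ∀ᶠ η : ℝ in 𝓝[>] 0, η < |signedEnergy m (full i p) j| := fun j =>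
    nhdsWithin_le_nhds (eventually_lt_nhds (abs_pos.2 (hp j)))
  have hall : ∀ᶠ η : ℝ in 𝓝[>] 0, ∀ j ∈ Finset.range (n + 1),
      η < |signedEnergy m (full i p) j| :=
    (Filter.eventually_all_finset _).2 fun j _ => hsmall j
  filter_upwards [hall] with η hη
  unfold cutIntegrand
  refine Finset.sum_congr rfl fun j _ => ?_
  have h1 := hη j (Finset.mem_range.2 (by omega))
  have h2 := hη (j + 1) (Finset.mem_range.2 (by omega))
  rw [cutPropagator_momenta m 0 j (sum_full i p), cutPropagator_momenta m η j (sum_full i p),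
    if_pos ⟨abs_pos.2 (hp j), abs_pos.2 (hp (j + 1))⟩, if_pos ⟨h1, h2⟩]

theorem tendsto_integral_cutIntegrand_of_tendsto {n s : ℕ} (hn : 3 ≤ n) (hs : 1 ≤ s)
    {m : Fin n → ℝ} (hm : ∀ l, 0 ≤ m l) (hm' : s ≤ 2 → ∀ l, 0 < m l) {F : Filter ℝ}
    [F.IsCountablyGenerated] {g : ℝ → Config n s → ℂ} {g₀ : Config n s → ℂ} {C : ℝ}
    (hg : ∀ᶠ ε in F, HasBound (g ε) C)
    (hlim : ∀ k, Tendsto (fun ε => g ε k) F (𝓝 (g₀ k))) (i : Fin n) :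
    Tendsto (fun ε => ∫ p : OtherMomenta s i, cutIntegrand m 0 (g ε) (full i p)) F
      (𝓝 (∫ p : OtherMomenta s i, cutIntegrand m 0 g₀ (full i p))) := by
  refine tendsto_integral_filter_of_dominated_convergence
    (fun p => 6 * n * C * dominator m (full i p))
    (hg.mono fun ε h => (measurable_cutIntegrand m 0 h.continuous i).aestronglyMeasurable)
    (hg.mono fun ε h => ae_norm_cutIntegrand_le hn hs m le_rfl h i)
    ((integrable_dominator hm hm' i).const_mul _) (Eventually.of_forall fun p => ?_)
  exact tendsto_finsetSum _ fun j _ => (hlim _).const_mul _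

/-! ### Functionals on Schwartz functions -/

theorem norm_le_card_mul {ι : Type*} [Fintype ι] {x : EuclideanSpace ℝ ι} {b : ℝ} (hb : 0 ≤ b)
    (h : ∀ i, |x i| ≤ b) : ‖x‖ ≤ Fintype.card ι * b := by
  rw [EuclideanSpace.norm_eq]
  refine Real.sqrt_le_iff.2 ⟨by positivity, ?_⟩
  have h1 : ∑ i, ‖x i‖ ^ 2 ≤ ∑ _i : ι, b ^ 2 :=
    Finset.sum_le_sum fun i _ => by
      rw [Real.norm_eq_abs]; exact pow_le_pow_left₀ (abs_nonneg _) (h i) 2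
  refine h1.trans ?_
  rw [Finset.sum_const, Finset.card_univ, nsmul_eq_mul, mul_pow]
  gcongr
  exact_mod_cast Nat.le_self_pow two_ne_zero _

section Comp

variable {n s : ℕ} {V : Type*} [NormedAddCommGroup V] [NormedSpace ℝ V]

theorem one_le_mul_prod_decay {K r : ℝ} (hK : 0 ≤ K) (hr : 0 ≤ r) (k : Config n s)
    (h : ∀ l, ‖space k l‖ ≤ K * r) :
    1 ≤ (1 + K) ^ (n * (s + 1)) * (1 + r) ^ (n * (s + 1)) * ∏ l, decay (space k l) := by
  have h1 : ∏ l, (1 + ‖space k l‖) ^ (s + 1) ≤ ∏ _l : Fin n, ((1 + K) * (1 + r)) ^ (s + 1) :=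
    Finset.prod_le_prod (fun l _ => by positivity) fun l _ => by
      gcongr
      nlinarith [h l]
  rw [Finset.prod_const, Finset.card_univ, Fintype.card_fin, ← pow_mul, mul_comm (s + 1), mul_pow]
    at h1
  have h2 : ∏ l, decay (space k l) = (∏ l, (1 + ‖space k l‖) ^ (s + 1))⁻¹ := by
    rw [← Finset.prod_inv_distrib]; rfl
  have h3 : 0 < ∏ l, (1 + ‖space k l‖) ^ (s + 1) := Finset.prod_pos fun l _ => by positivity
  rw [h2, ← div_eq_mul_inv, one_le_div h3]
  exact h1

/-- `A` may forget energies but must control the space momenta. It is used for the identity and for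
the projection to the reduced variables. Seminorms of order `n * (s + 1)` pay for the `n` factors
`decay`, one derivative for the Lipschitz bound. -/
theorem exists_hasBound_comp (A : Config n s →L[ℝ] V) {K : ℝ} (hK : 0 ≤ K)
    (hA : ∀ k l, ‖space k l‖ ≤ K * ‖A k‖) :
    ∃ D : ℝ, 0 ≤ D ∧ ∀ g : SchwartzMap V ℂ, HasBound (fun k => g (A k))
      (D * ((Finset.Iic (n * (s + 1), 1)).sup (schwartzSeminormFamily ℂ V ℂ)) g) := by
  set M := n * (s + 1)
  let N : ℝ := ((Fintype.card (Fin n × Fin (s + 1)) : ℕ) : ℝ)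
  refine ⟨(1 + K) ^ M * 2 ^ M * (1 + ‖A‖ * N), by positivity, fun g => ?_⟩
  set S := ((Finset.Iic (M, 1)).sup (schwartzSeminormFamily ℂ V ℂ)) g
  have hS0 : 0 ≤ S := apply_nonneg _ _
  have hder : ∀ i ≤ 1, ∀ k : Config n s, ‖iteratedFDeriv ℝ i g (A k)‖ ≤
      (1 + K) ^ M * 2 ^ M * S * ∏ l, decay (space k l) := by
    intro i hi k
    have h1 := one_le_mul_prod_decay hK (norm_nonneg (A k)) k (hA k)
    have h2 := SchwartzMap.one_add_le_sup_seminorm_apply (𝕜 := ℂ) (m := (M, 1)) le_rfl hi g (A k)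
    have hd : 0 ≤ ∏ l, decay (space k l) := Finset.prod_nonneg fun l _ => (decay_pos _).le
    calc ‖iteratedFDeriv ℝ i g (A k)‖ ≤ ‖iteratedFDeriv ℝ i g (A k)‖ *
          ((1 + K) ^ M * (1 + ‖A k‖) ^ M * ∏ l, decay (space k l)) :=
        le_mul_of_one_le_right (norm_nonneg _) h1
      _ = (1 + K) ^ M * ((1 + ‖A k‖) ^ M * ‖iteratedFDeriv ℝ i g (A k)‖) *
          ∏ l, decay (space k l) := by ring
      _ ≤ (1 + K) ^ M * (2 ^ M * S) * ∏ l, decay (space k l) :=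
        mul_le_mul_of_nonneg_right (mul_le_mul_of_nonneg_left h2 (by positivity)) hd
      _ = _ := by ring
  have hN0 : 0 ≤ N := Nat.cast_nonneg _
  refine ⟨g.continuous.comp A.continuous, fun k => ?_, fun k k' b hb hk hkb => ?_⟩
  · have h := hder 0 zero_le_one k
    rw [norm_iteratedFDeriv_zero] at h
    refine h.trans ?_
    have hd : 0 ≤ ∏ l, decay (space k l) := Finset.prod_nonneg fun l _ => (decay_pos _).le
    have h1 : (1 + K) ^ M * 2 ^ M ≤ (1 + K) ^ M * 2 ^ M * (1 + ‖A‖ * N) :=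
      le_mul_of_one_le_right (by positivity) (by linarith [mul_nonneg (norm_nonneg A) hN0])
    gcongr
  · have hd : 0 ≤ ∏ l, decay (space k l) := Finset.prod_nonneg fun l _ => (decay_pos _).le
    -- The mean value inequality is applied on the affine set of fixed space momenta, where the
    -- product of the `decay` factors is constant.
    have hconv : Convex ℝ {x : Config n s | space x = space k} := by
      intro x hx y hy u v _ _ huv
      funext l a
      have h1 : x (l, a.succ) = k (l, a.succ) := congrFun (congrFun hx l) a
      have h2 : y (l, a.succ) = k (l, a.succ) := congrFun (congrFun hy l) a
      change u * x (l, a.succ) + v * y (l, a.succ) = k (l, a.succ)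
      rw [h1, h2, ← add_mul, huv, one_mul]
    have hfd : ∀ x ∈ {x : Config n s | space x = space k},
        HasFDerivWithinAt (fun x => g (A x)) ((fderiv ℝ g (A x)).comp A)
          {x : Config n s | space x = space k} x := fun x _ =>
      ((g.differentiableAt.hasFDerivAt).comp x A.hasFDerivAt).hasFDerivWithinAt
    have hmv := hconv.norm_image_sub_le_of_norm_hasFDerivWithin_le
      (C := (1 + K) ^ M * 2 ^ M * S * (∏ l, decay (space k l)) * ‖A‖) hfd
      (fun x hx => by
        refine (ContinuousLinearMap.opNorm_comp_le _ _).trans ?_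
        have h := hder 1 le_rfl x
        have hx' : space x = space k := hx
        rw [norm_iteratedFDeriv_one, hx'] at h
        gcongr) (x := k') (y := k) hk.symm rfl
    have hkk : ‖k - k'‖ ≤ N * b := norm_le_card_mul hb hkb
    refine hmv.trans ?_
    calc _ ≤ (1 + K) ^ M * 2 ^ M * S * (∏ l, decay (space k l)) * ‖A‖ * (N * b) := by gcongr
      _ = (1 + K) ^ M * 2 ^ M * (‖A‖ * N) * S * (∏ l, decay (space k l)) * b := by ring
      _ ≤ _ := by gcongr; linarith

theorem exists_functional (hn : 3 ≤ n) (hs : 1 ≤ s) {m : Fin n → ℝ}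
    (hm : ∀ l, 0 ≤ m l) (hm' : s ≤ 2 → ∀ l, 0 < m l) (i : Fin n)
    (A : Config n s →L[ℝ] V) {K : ℝ} (hK : 0 ≤ K) (hA : ∀ k l, ‖space k l‖ ≤ K * ‖A k‖) :
    ∃ T : SchwartzMap V ℂ →L[ℂ] ℂ, ∀ g : SchwartzMap V ℂ,
      T g = ∫ p : OtherMomenta s i, cutIntegrand m 0 (fun k => g (A k)) (full i p) := by
  obtain ⟨D, hD, hbound⟩ := exists_hasBound_comp A hK hA
  have hint := fun g => integrable_cutIntegrand hn hs hm hm' le_rfl (hbound g) i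
  have hI : 0 ≤ ∫ p : OtherMomenta s i, dominator m (full i p) :=
    integral_nonneg fun p => Finset.sum_nonneg fun t _ => Finset.prod_nonneg fun l _ =>
      mul_nonneg (sq_nonneg _) (decay_pos _).le
  refine ⟨SchwartzMap.mkCLMtoNormedSpace (fun g : SchwartzMap V ℂ =>
    ∫ p : OtherMomenta s i, cutIntegrand m 0 (fun k => g (A k)) (full i p)) ?_ ?_ ?_,
    fun g => rfl⟩
  · intro g h
    rw [← integral_add (hint g) (hint h)]
    exact integral_congr_ae (Eventually.of_forall fun p => cutIntegrand_add m 0 _ _ _)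
  · intro c g
    rw [RingHom.id_apply, smul_eq_mul, ← integral_const_mul]
    exact integral_congr_ae (Eventually.of_forall fun p => cutIntegrand_const_mul m 0 c _ _)
  · refine ⟨Finset.Iic (n * (s + 1), 1),
      6 * n * D * ∫ p : OtherMomenta s i, dominator m (full i p), by positivity, fun g => ?_⟩
    refine (norm_integral_cutIntegrand_le hn hs hm hm' le_rfl (hbound g) i).trans_eq ?_
    ring

end Comp

/-! ### The distribution in momentum space -/

theorem norm_space_le {n s : ℕ} (k : Config n s) (l : Fin n) : ‖space k l‖ ≤ ‖k‖ :=
  (pi_norm_le_iff_of_nonneg (norm_nonneg k)).2 fun a => PiLp.norm_apply_le k (l, a.succ)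

theorem exists_isStructureDistribution {n s : ℕ} (hn : 3 ≤ n) (hs : 1 ≤ s) {m : Fin n → ℝ}
    (hm : ∀ l, 0 ≤ m l) (hm' : s ≤ 2 → ∀ l, 0 < m l) (i : Fin n) :
    ∃ T : TemperedDistribution (Config n s) ℂ, IsStructureDistribution m T ∧
      ∀ g, T g = ∫ p : OtherMomenta s i, cutIntegrand m 0 g (full i p) := by
  have hA : ∀ (k : Config n s) l, ‖space k l‖ ≤ 1 * ‖ContinuousLinearMap.id ℝ (Config n s) k‖ :=
    fun k l => by rw [one_mul]; exact norm_space_le k l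
  obtain ⟨T, hT⟩ := exists_functional hn hs hm hm' i _ zero_le_one hA
  obtain ⟨D, -, hD⟩ := exists_hasBound_comp _ zero_le_one hA
  have hbound : ∀ g : SchwartzMap (Config n s) ℂ, HasBound g _ := hD
  refine ⟨ContinuousLinearMap.toPointwiseConvergenceCLM _ _ _ _ T, ⟨fun g η hη j =>
    integrable_summand hm hm' hη (hbound g) j, fun g => ?_⟩, hT⟩
  have h := tendsto_integral_cutIntegrand hn hs hm hm' (hbound g) i
  refine (Tendsto.congr' ?_ h).trans_eq (congrArg 𝓝 (hT g).symm)
  exact eventually_nhdsWithin_of_forall fun η (hη : 0 < η) =>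
    (sum_integral_summand m η g (fun j => integrable_summand hm hm' hη (hbound g) j) i).symm

theorem HasBound.mul {n s : ℕ} {g X : Config n s → ℂ} {C M₁ M₂ : ℝ} (hg : HasBound g C)
    (hX : Continuous X) (h₁ : ∀ k, ‖X k‖ ≤ M₁)
    (h₂ : ∀ (k k' : Config n s) (b : ℝ), 0 ≤ b → (∀ i, |k i - k' i| ≤ b) → ‖X k - X k'‖ ≤ M₂ * b) :
    HasBound (fun k => g k * X k) (C * (M₁ + M₂)) := by
  have hC := hg.nonneg
  have hM₁ : 0 ≤ M₁ := (norm_nonneg _).trans (h₁ 0)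
  have hM₂ : 0 ≤ M₂ := by
    simpa using (norm_nonneg _).trans (h₂ 0 0 1 zero_le_one fun i => by simp)
  have hd : ∀ k : Config n s, 0 ≤ ∏ l, decay (space k l) := fun k =>
    Finset.prod_nonneg fun l _ => (decay_pos _).le
  refine ⟨hg.continuous.mul hX, fun k => ?_, fun k k' b hb hk hkb => ?_⟩
  · rw [norm_mul]
    calc ‖g k‖ * ‖X k‖ ≤ (C * ∏ l, decay (space k l)) * M₁ :=
          mul_le_mul (hg.norm_le k) (h₁ k) (norm_nonneg _) (mul_nonneg hC (hd k))
      _ = C * M₁ * ∏ l, decay (space k l) := by ring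
      _ ≤ _ := by
          have := hd k
          gcongr
          linarith
  · have e : g k * X k - g k' * X k' = (g k - g k') * X k' + g k * (X k - X k') := by ring
    rw [e]
    refine (norm_add_le _ _).trans ?_
    rw [norm_mul, norm_mul]
    have h3 := hd k
    have h4 : ‖g k - g k'‖ * ‖X k'‖ ≤ (C * (∏ l, decay (space k l)) * b) * M₁ :=
      mul_le_mul (hg.norm_sub_le k k' b hb hk hkb) (h₁ k') (norm_nonneg _) (by positivity)
    have h5 : ‖g k‖ * ‖X k - X k'‖ ≤ (C * ∏ l, decay (space k l)) * (M₂ * b) :=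
      mul_le_mul (hg.norm_le k) (h₂ k k' b hb hkb) (norm_nonneg _) (by positivity)
    linarith

/-! ### The Fourier transform of smeared functions -/

/-- The indices that `ReducedIndex` leaves out. -/
theorem removed_iff {n s j : ℕ} (hj : j + 1 < n) (i : Fin n × Fin (s + 1)) :
    i ∈ ({(⟨j, Nat.lt_of_succ_lt hj⟩, 0), (⟨j + 1, hj⟩, 0)} : Finset (Fin n × Fin (s + 1))) ↔
      i.2 = 0 ∧ ((i.1 : ℕ) = j ∨ (i.1 : ℕ) = j + 1) := by
  obtain ⟨l, μ⟩ := i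
  simp only [Finset.mem_insert, Finset.mem_singleton, Prod.mk.injEq, Fin.ext_iff]
  tauto

theorem prod_removed {n s j : ℕ} (hj : j + 1 < n) {M : Type*} [CommMonoid M]
    (f : Fin n × Fin (s + 1) → M) :
    ∏ i : {i : Fin n × Fin (s + 1) // i.2 = 0 ∧ ((i.1 : ℕ) = j ∨ (i.1 : ℕ) = j + 1)}, f i =
      f (⟨j, Nat.lt_of_succ_lt hj⟩, 0) * f (⟨j + 1, hj⟩, 0) := by
  rw [← Finset.prod_subtype _ (removed_iff hj) f, Finset.prod_pair (by simp)]

theorem inner_eq_reduce {n s j : ℕ} (hj : j + 1 < n) (x y : Config n s) :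
    inner ℝ x y = inner ℝ (reduce n s j x) (reduce n s j y) +
      (x (⟨j, Nat.lt_of_succ_lt hj⟩, 0) * y (⟨j, Nat.lt_of_succ_lt hj⟩, 0) +
        x (⟨j + 1, hj⟩, 0) * y (⟨j + 1, hj⟩, 0)) := by
  -- The product formula, read in `Multiplicative ℝ`, is the corresponding formula for sums.
  have hrem := congrArg Multiplicative.toAdd (prod_removed hj (M := Multiplicative ℝ)
    fun i : Fin n × Fin (s + 1) => Multiplicative.ofAdd (x i * y i))
  simp only [PiLp.inner_apply, reduce_apply]
  have e : ∀ a b : ℝ, inner ℝ a b = a * b := fun a b => by simp [mul_comm]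
  simp only [e]
  rw [← Fintype.sum_subtype_add_sum_subtype
    (fun i : Fin n × Fin (s + 1) => i.2 = 0 ∧ ((i.1 : ℕ) = j ∨ (i.1 : ℕ) = j + 1))
    (fun i => x i * y i), add_comm]
  congr 1

theorem integral_reduce_mul {n s j : ℕ} (hj : j + 1 < n) (H : ReducedConfig n s j → ℂ)
    (ψ₁ ψ₂ : ℝ → ℂ) :
    ∫ x : Config n s, H (reduce n s j x) *
      (ψ₁ (x (⟨j, Nat.lt_of_succ_lt hj⟩, 0)) * ψ₂ (x (⟨j + 1, hj⟩, 0))) =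
      (∫ y, H y) * ((∫ t, ψ₁ t) * ∫ t, ψ₂ t) := by
  let p : Fin n × Fin (s + 1) → Prop := fun i =>
    i.2 = 0 ∧ ((i.1 : ℕ) = j ∨ (i.1 : ℕ) = j + 1)
  let Ψ : Fin n × Fin (s + 1) → ℝ → ℂ := fun i =>
    if i = (⟨j, Nat.lt_of_succ_lt hj⟩, 0) then ψ₁ else ψ₂
  have hΨ₁ : Ψ (⟨j, Nat.lt_of_succ_lt hj⟩, 0) = ψ₁ := if_pos rfl
  have hΨ₂ : Ψ (⟨j + 1, hj⟩, 0) = ψ₂ := if_neg (by simp)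
  have hmp := volume_preserving_piEquivPiSubtypeProd (fun _ : Fin n × Fin (s + 1) => ℝ) p
  have h1 : ∀ x : Config n s, H (reduce n s j x) *
      (ψ₁ (x (⟨j, Nat.lt_of_succ_lt hj⟩, 0)) * ψ₂ (x (⟨j + 1, hj⟩, 0))) =
      (fun z : ({i // p i} → ℝ) × ({i // ¬p i} → ℝ) =>
        (∏ i : {i // p i}, Ψ i (z.1 i)) * H (WithLp.toLp 2 z.2))
        (MeasurableEquiv.piEquivPiSubtypeProd (fun _ => ℝ) p (WithLp.ofLp x)) := by
    intro x
    have h := prod_removed hj fun i => Ψ i (x i)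
    rw [hΨ₁, hΨ₂] at h
    rw [← h, mul_comm]
    rfl
  rw [integral_congr_ae (Eventually.of_forall h1),
    (PiLp.volume_preserving_ofLp (Fin n × Fin (s + 1))).integral_comp
      (MeasurableEquiv.toLp 2 (Fin n × Fin (s + 1) → ℝ)).symm.measurableEmbedding
      (fun x => (fun z : ({i // p i} → ℝ) × ({i // ¬p i} → ℝ) =>
        (∏ i : {i // p i}, Ψ i (z.1 i)) * H (WithLp.toLp 2 z.2))
        (MeasurableEquiv.piEquivPiSubtypeProd (fun _ => ℝ) p x))]
  refine (hmp.integral_comp' (g := fun z : ({i // p i} → ℝ) × ({i // ¬p i} → ℝ) =>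
    (∏ i : {i // p i}, Ψ i (z.1 i)) * H (WithLp.toLp 2 z.2))).trans ?_
  rw [Measure.volume_eq_prod,
    integral_prod_mul (fun z : {i // p i} → ℝ => ∏ i : {i // p i}, Ψ i (z i))
      (fun z : {i // ¬p i} → ℝ => H (WithLp.toLp 2 z)),
    integral_fintype_prod_volume_eq_prod (fun i : {i // p i} => Ψ i),
    prod_removed hj fun i => ∫ t, Ψ i t, hΨ₁, hΨ₂, mul_comm]
  congr 1
  exact (PiLp.volume_preserving_toLp {i // ¬p i}).integral_comp
    (MeasurableEquiv.toLp 2 ({i // ¬p i} → ℝ)).measurableEmbedding H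

theorem fourierInv_approxDelta (φ : SchwartzMap ℝ ℝ) {ε : ℝ} (hε : 0 < ε) (τ : ℝ) :
    ∫ x : ℝ, Complex.exp ((2 * Real.pi * (x * τ) : ℝ) * Complex.I) * approxDelta φ ε 0 x =
      𝓕 (SchwartzMap.postcompCLM (𝕜 := ℝ) Complex.ofRealCLM φ) (ε * τ) := by
  -- The substitution `x ↦ -ε x` undoes the scaling and the reflection in `φ_ε(-x)`, turning the
  -- inverse transform into the Fourier transform of `φ` at `ε τ`.
  have h := Measure.integral_comp_mul_left (fun x : ℝ =>
    Complex.exp ((2 * Real.pi * (x * τ) : ℝ) * Complex.I) * approxDelta φ ε 0 x) (-ε)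
  have hε' : |(-ε)⁻¹| = ε⁻¹ := by rw [abs_inv, abs_neg, abs_of_pos hε]
  rw [hε'] at h
  have h2 : ∫ x : ℝ, Complex.exp ((2 * Real.pi * (x * τ) : ℝ) * Complex.I) *
      approxDelta φ ε 0 x = ε • ∫ x : ℝ,
        Complex.exp ((2 * Real.pi * (-ε * x * τ) : ℝ) * Complex.I) *
          approxDelta φ ε 0 (-ε * x) := by
    rw [h, smul_smul, mul_inv_cancel₀ hε.ne', one_smul]
  rw [h2, SchwartzMap.fourier_coe, Real.fourier_eq', ← integral_smul]
  refine integral_congr_ae (Eventually.of_forall fun x => ?_)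
  have h3 : (0 - -ε * x) / ε = x := by field_simp; ring
  simp only [approxDelta_apply, h3]
  have h4 : ((2 * Real.pi * (-ε * x * τ) : ℝ) : ℂ) =
      ((-2 * Real.pi * inner ℝ x (ε * τ) : ℝ) : ℂ) := by
    congr 1
    simp
    ring
  rw [h4]
  have : (ε : ℂ) ≠ 0 := by exact_mod_cast hε.ne'
  simp only [Complex.real_smul, smul_eq_mul, Complex.ofReal_div]
  field_simp
  rfl

theorem fourierInvCLM_smearCLM {n s : ℕ} (φ : SchwartzMap ℝ ℝ) (j : ℕ) (hj : j + 1 < n) {ε : ℝ}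
    (hε : 0 < ε) (f : SchwartzMap (ReducedConfig n s j) ℂ) (k : Config n s) :
    fourierInvCLM n s (smearCLM φ j hj ε 0 0 f) k =
      (𝓕⁻ f) (reduce n s j (rescale n s k)) *
        ((((2 * Real.pi) ^ (-((n : ℝ) * ((s : ℝ) + 1) / 2)) : ℝ) : ℂ) *
        (𝓕 (SchwartzMap.postcompCLM (𝕜 := ℝ) Complex.ofRealCLM φ)
            (ε * rescale n s k (⟨j, Nat.lt_of_succ_lt hj⟩, 0)) *
          𝓕 (SchwartzMap.postcompCLM (𝕜 := ℝ) Complex.ofRealCLM φ)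
            (ε * rescale n s k (⟨j + 1, hj⟩, 0)))) := by
  have h : fourierInvCLM n s (smearCLM φ j hj ε 0 0 f) k =
      (((2 * Real.pi) ^ (-((n : ℝ) * ((s : ℝ) + 1) / 2)) : ℝ) : ℂ) *
      (𝓕⁻ (smearCLM φ j hj ε 0 0 f)) (rescale n s k) := rfl
  set ξ := rescale n s k
  have hint := integral_reduce_mul hj
    (fun y => Complex.exp ((2 * Real.pi * inner ℝ y (reduce n s j ξ) : ℝ) * Complex.I) * f y)
    (fun t => Complex.exp ((2 * Real.pi * (t * ξ (⟨j, Nat.lt_of_succ_lt hj⟩, 0)) : ℝ) *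
      Complex.I) * approxDelta φ ε 0 t)
    (fun t => Complex.exp ((2 * Real.pi * (t * ξ (⟨j + 1, hj⟩, 0)) : ℝ) *
      Complex.I) * approxDelta φ ε 0 t)
  rw [fourierInv_approxDelta φ hε, fourierInv_approxDelta φ hε] at hint
  rw [h, SchwartzMap.fourierInv_coe, Real.fourierInv_eq', SchwartzMap.fourierInv_coe,
    Real.fourierInv_eq']
  simp only [smul_eq_mul]
  rw [mul_left_comm, ← hint]
  congr 1
  refine integral_congr_ae (Eventually.of_forall fun x => ?_)
  simp only
  rw [smearCLM_apply, inner_eq_reduce hj x ξ, approxDelta_apply, approxDelta_apply, mul_add,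
    mul_add, Complex.ofReal_add, Complex.ofReal_add, add_mul, add_mul, Complex.exp_add,
    Complex.exp_add]
  ring

theorem norm_sub_le_seminorm_mul (Φ : SchwartzMap ℝ ℂ) (x y : ℝ) :
    ‖Φ x - Φ y‖ ≤ SchwartzMap.seminorm ℝ 0 1 Φ * |x - y| := by
  rw [← Real.norm_eq_abs]
  refine convex_univ.norm_image_sub_le_of_norm_deriv_le (𝕜 := ℝ)
    (fun x _ => Φ.differentiableAt) (fun x _ => ?_) (Set.mem_univ y) (Set.mem_univ x)
  rw [← iteratedDeriv_one, ← norm_iteratedFDeriv_eq_norm_iteratedDeriv]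
  simpa using SchwartzMap.le_seminorm ℝ 0 1 Φ x

theorem abs_rescale_sub_le {n s : ℕ} {k k' : Config n s} {b : ℝ} (h : ∀ i, |k i - k' i| ≤ b)
    (l : Fin n) : |rescale n s k (l, 0) - rescale n s k' (l, 0)| ≤ b := by
  have e : ∀ x : Config n s, rescale n s x (l, 0) = (2 * Real.pi)⁻¹ * x (l, 0) := fun x => by
    change (2 * Real.pi)⁻¹ * metricSign (0 : Fin (s + 1)) * x (l, 0) = _
    simp [metricSign]
  rw [e, e, ← mul_sub, abs_mul, abs_of_pos (by positivity)]
  refine (mul_le_of_le_one_left (abs_nonneg _) ?_).trans (h _)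
  exact inv_le_one_of_one_le₀ (by linarith [Real.two_le_pi])

theorem norm_space_le_reduce_rescale {n s : ℕ} (j : ℕ) (k : Config n s) (l : Fin n) :
    ‖space k l‖ ≤ 2 * Real.pi *
      ‖((reduce n s j).comp (rescale n s : Config n s →L[ℝ] Config n s)) k‖ := by
  refine (pi_norm_le_iff_of_nonneg (by positivity)).2 fun a => ?_
  have hne : ¬((l, a.succ) : Fin n × Fin (s + 1)).2 = 0 := Fin.succ_ne_zero a
  have h := PiLp.norm_apply_le (p := 2)
    (((reduce n s j).comp (rescale n s : Config n s →L[ℝ] Config n s)) k)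
    (⟨(l, a.succ), fun h => hne h.1⟩ : ReducedIndex n s j)
  have e : ((reduce n s j).comp (rescale n s : Config n s →L[ℝ] Config n s)) k
      (⟨(l, a.succ), fun h => hne h.1⟩ : ReducedIndex n s j) =
      (2 * Real.pi)⁻¹ * metricSign a.succ * k (l, a.succ) := rfl
  rw [e, metricSign, if_neg (Fin.succ_ne_zero a), norm_mul, norm_mul, norm_neg, norm_one, mul_one,
    Real.norm_of_nonneg (by positivity), inv_mul_le_iff₀ (by positivity)] at h
  exact h

theorem fourier_zero_eq_one {φ : SchwartzMap ℝ ℝ} (hφ : IsMollifier φ) :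
    𝓕 (SchwartzMap.postcompCLM (𝕜 := ℝ) Complex.ofRealCLM φ) 0 = 1 := by
  rw [SchwartzMap.fourier_coe, Real.fourier_eq']
  have h : ∫ x, ((φ x : ℝ) : ℂ) = 1 := by
    rw [integral_complex_ofReal, hφ.integral_eq_one, Complex.ofReal_one]
  rw [← h]
  refine integral_congr_ae (Eventually.of_forall fun x => ?_)
  simp

/-! ### The limit at time zero -/

/-- The value of the distribution on smeared functions converges. -/
theorem exists_tendsto_smear {n s : ℕ} (hn : 3 ≤ n) (hs : 1 ≤ s) {m : Fin n → ℝ}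
    (hm : ∀ l, 0 ≤ m l) (hm' : s ≤ 2 → ∀ l, 0 < m l) (i : Fin n)
    {T : TemperedDistribution (Config n s) ℂ}
    (hT : ∀ g, T g = ∫ p : OtherMomenta s i, cutIntegrand m 0 g (full i p))
    {φ : SchwartzMap ℝ ℝ} (hφ : IsMollifier φ) (j : ℕ) (hj : j + 1 < n) :
    ∃ W : SchwartzMap (ReducedConfig n s j) ℂ →L[ℂ] ℂ, ∀ f,
      Tendsto (fun ε : ℝ => T (fourierInvCLM n s (smearCLM φ j hj ε 0 0 f))) (𝓝[>] 0)
        (𝓝 (W f)) := by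
  have hK : 0 ≤ 2 * Real.pi := by positivity
  obtain ⟨T₀, hT₀⟩ := exists_functional hn hs hm hm' i _ hK (norm_space_le_reduce_rescale j)
  obtain ⟨D, hD, hbound⟩ := exists_hasBound_comp (n := n) (s := s) _ hK
    (norm_space_le_reduce_rescale j)
  set c : ℂ := (((2 * Real.pi) ^ (-((n : ℝ) * ((s : ℝ) + 1) / 2)) : ℝ) : ℂ) with hc
  set Φ : SchwartzMap ℝ ℂ := 𝓕 (SchwartzMap.postcompCLM (𝕜 := ℝ) Complex.ofRealCLM φ) with hΦ
  refine ⟨c • T₀ ∘L FourierTransform.fourierInvCLM ℂ (SchwartzMap (ReducedConfig n s j) ℂ),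
    fun f => ?_⟩
  let X : ℝ → Config n s → ℂ := fun ε k =>
    c * (Φ (ε * rescale n s k (⟨j, Nat.lt_of_succ_lt hj⟩, 0)) *
      Φ (ε * rescale n s k (⟨j + 1, hj⟩, 0)))
  set M := SchwartzMap.seminorm ℝ 0 0 Φ with hM
  set L := SchwartzMap.seminorm ℝ 0 1 Φ with hL
  have hM0 : 0 ≤ M := apply_nonneg _ _
  have hL0 : 0 ≤ L := apply_nonneg _ _
  have hΦM : ∀ x, ‖Φ x‖ ≤ M := fun x => SchwartzMap.norm_le_seminorm ℝ Φ x
  have hXcont : ∀ ε, Continuous (X ε) := fun ε => by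
    have hcoord : ∀ i, Continuous fun k : Config n s => rescale n s k i := fun i =>
      (EuclideanSpace.proj (𝕜 := ℝ) i).continuous.comp (rescale n s).continuous
    exact continuous_const.mul ((Φ.continuous.comp (continuous_const.mul (hcoord _))).mul
      (Φ.continuous.comp (continuous_const.mul (hcoord _))))
  have hX1 : ∀ ε k, ‖X ε k‖ ≤ ‖c‖ * (M * M) := fun ε k => by
    simp only [X, norm_mul]
    gcongr <;> exact hΦM _
  -- For `ε ≤ 1` the scaling does not increase Lipschitz constants, so the bound is uniform in `ε`.
  have hX2 : ∀ ε ∈ Set.Ioc (0 : ℝ) 1, ∀ (k k' : Config n s) (b : ℝ), 0 ≤ b →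
      (∀ i, |k i - k' i| ≤ b) → ‖X ε k - X ε k'‖ ≤ ‖c‖ * (L * M + M * L) * b := by
    intro ε hε k k' b hb hkb
    have hdiff : ∀ l, ‖Φ (ε * rescale n s k (l, 0)) - Φ (ε * rescale n s k' (l, 0))‖ ≤ L * b := by
      intro l
      refine (norm_sub_le_seminorm_mul Φ _ _).trans ?_
      rw [← mul_sub, abs_mul, abs_of_pos hε.1]
      gcongr
      exact (mul_le_of_le_one_left (abs_nonneg _) hε.2).trans (abs_rescale_sub_le hkb l)
    have e : ∀ a b a' b' : ℂ, c * (a * b) - c * (a' * b') =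
        c * ((a - a') * b + a' * (b - b')) := fun a b a' b' => by ring
    simp only [X]
    rw [e, norm_mul, mul_assoc]
    refine mul_le_mul_of_nonneg_left ((norm_add_le _ _).trans ?_) (norm_nonneg _)
    rw [norm_mul, norm_mul]
    calc _ ≤ (L * b) * M + M * (L * b) := by
          gcongr
          · exact hdiff _
          · exact hΦM _
          · exact hΦM _
          · exact hdiff _
      _ = _ := by ring
  have hXlim : ∀ k, Tendsto (fun ε => X ε k) (𝓝[>] 0) (𝓝 c) := by
    intro k
    have h1 : ∀ x : ℝ, Tendsto (fun ε : ℝ => Φ (ε * x)) (𝓝[>] 0) (𝓝 1) := fun x => by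
      have : Continuous fun ε : ℝ => Φ (ε * x) := Φ.continuous.comp (by fun_prop)
      have h := this.tendsto 0
      rw [zero_mul, hΦ, fourier_zero_eq_one hφ] at h
      exact h.mono_left nhdsWithin_le_nhds
    simpa using ((h1 _).mul (h1 _)).const_mul c
  have hlim := tendsto_integral_cutIntegrand_of_tendsto hn hs hm hm' (F := 𝓝[>] 0)
    (g := fun ε k => (𝓕⁻ f) (((reduce n s j).comp
      (rescale n s : Config n s →L[ℝ] Config n s)) k) * X ε k)
    (g₀ := fun k => (𝓕⁻ f) (((reduce n s j).comp
      (rescale n s : Config n s →L[ℝ] Config n s)) k) * c)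
    (by
      filter_upwards [Ioc_mem_nhdsGT (zero_lt_one' ℝ)] with ε hε
      exact (hbound (𝓕⁻ f)).mul (hXcont ε) (hX1 ε) (hX2 ε hε))
    (fun k => (hXlim k).const_mul _) i
  have hW : (c • T₀ ∘L FourierTransform.fourierInvCLM ℂ (SchwartzMap (ReducedConfig n s j) ℂ)) f =
      ∫ p : OtherMomenta s i, cutIntegrand m 0 (fun k => (𝓕⁻ f) (((reduce n s j).comp
        (rescale n s : Config n s →L[ℝ] Config n s)) k) * c) (full i p) := by
    change c * T₀ (𝓕⁻ f) = _
    rw [hT₀, ← integral_const_mul]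
    refine integral_congr_ae (Eventually.of_forall fun p => ?_)
    simp only [mul_comm _ c]
    rw [mul_comm, cutIntegrand_const_mul, mul_comm]
  rw [hW]
  refine hlim.congr' ?_
  filter_upwards [self_mem_nhdsWithin] with ε hε
  rw [hT]
  have : (fun k => (𝓕⁻ f) (((reduce n s j).comp
      (rescale n s : Config n s →L[ℝ] Config n s)) k) * X ε k) =
      fourierInvCLM n s (smearCLM φ j hj ε 0 0 f) := by
    funext k
    exact (fourierInvCLM_smearCLM φ j hj hε f k).symm
  rw [this]

end StructureFunction

end

/-! ### Summation over the mass labels -/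

theorem mainTheorem3 (n s N : ℕ) (hn : 3 ≤ n) (hs : 1 ≤ s) (m : Fin N → ℝ)
    (hm : ∀ κ, 0 ≤ m κ) (hm' : s ≤ 2 → ∀ κ, 0 < m κ) :
    ∃ Ghat : (Fin n → Fin N) → TemperedDistribution (StructureFunction.Config n s) ℂ,
      (∀ κ, StructureFunction.IsStructureDistribution (fun l => m (κ l)) (Ghat κ)) ∧
      ∀ φ : SchwartzMap ℝ ℝ, StructureFunction.IsMollifier φ →
        StructureFunction.WeakTimeZero φ (StructureFunction.fourierInv (∑ κ, Ghat κ)) := by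
  -- The momentum eliminated in the common coordinates; any index would do.
  let i : Fin n := ⟨0, by omega⟩
  choose Ghat hG hGint using fun κ : Fin n → Fin N =>
    StructureFunction.exists_isStructureDistribution hn hs (m := fun l => m (κ l))
      (fun l => hm (κ l)) (fun h l => hm' h (κ l)) i
  refine ⟨Ghat, hG, fun φ hφ j hj => ?_⟩
  choose W hW using fun κ : Fin n → Fin N =>
    StructureFunction.exists_tendsto_smear hn hs (m := fun l => m (κ l))
      (fun l => hm (κ l)) (fun h l => hm' h (κ l)) i (hGint κ) hφ j hj
  refine ⟨ContinuousLinearMap.toPointwiseConvergenceCLM _ _ _ _ (∑ κ, W κ), ?_⟩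
  refine PointwiseConvergenceCLM.tendsto_iff_forall_tendsto.2 fun f => ?_
  have hsum : (ContinuousLinearMap.toPointwiseConvergenceCLM ℂ (RingHom.id ℂ)
      (SchwartzMap (StructureFunction.ReducedConfig n s j) ℂ) ℂ (∑ κ, W κ)) f = ∑ κ, W κ f :=
    sum_apply _ _ _
  have hsum' : ∀ ε : ℝ, StructureFunction.atTimes φ (StructureFunction.fourierInv (∑ κ, Ghat κ))
      j hj ε 0 0 f = ∑ κ, Ghat κ (StructureFunction.fourierInvCLM n s
        (StructureFunction.smearCLM φ j hj ε 0 0 f)) := fun ε => by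
    rw [StructureFunction.atTimes_apply, StructureFunction.fourierInv_apply]
    exact sum_apply _ _ _
  rw [hsum]
  simp only [hsum']
  exact tendsto_finsetSum _ fun κ _ => hW κ f
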